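/- Let $h_0>0$ and $\eta\in(0,1)$ be constants, and let $(p_\gamma)_\gamma\subset[1,2]$, $(\mu_\gamma)_\gamma\subset(0,\infty)$ and $(\bar r_\gamma)_\gamma\subset(0,\infty)$ be families indexed by large real $\gamma>0$. Let $\lambda_\gamma>0$ be given by $$\lambda_\gamma p_\gamma^2\gamma^{2(p_\gamma-1)}\mu_\gamma^2e^{\gamma^{p_\gamma}}=8,$$ and set $t_\gamma(x)=\ln\left(1+|x|^2/\mu_\gamma^2\right)$ for $x\in\mathbb R^2$. For radially symmetric $f$ write $f(r)$ for the value $f(x)$ at $|x|=r$, and $f'$ for the derivative in $r$. Assume that $\mu_\gamma/\bar r_\gamma\to0$ as $\gamma\to+\infty$, that $t_\gamma(\bar r_\gamma)\le\eta\,p_\gamma\gamma^{p_\gamma}/2$ for all large $\gamma$, and that $\gamma^{2p_\gamma}\bar r_\gamma^2=O(1)$ as $\gamma\to+\infty$. For $s>0$, call $B$ a bubble of height $\gamma$ on the disk $B_s(0)\subset\mathbb R^2$ if $B$ is of class $C^2$, positive and radially symmetric in $B_s(0)$, $B(0)=\gamma$, and, with $\Delta=-\partial_{xx}-\partial_{yy}$,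 $$\Delta B+h_0B=\lambda_\gamma p_\gamma B^{p_\gamma-1}e^{B^{p_\gamma}}\quad\text{in }B_s(0).$$ Then for all large $\gamma$ there is a bubble of height $\gamma$ on $B_s(0)$ for some $s>\bar r_\gamma$ (so that the bubble is well defined and positive on the closed disk of radius $\bar r_\gamma$). Moreover, for all large $\gamma$, every bubble $B_\gamma$ of height $\gamma$ on a disk $B_s(0)$ satisfies the following for all $r\in[0,\bar r_\gamma]$ with $r<s$ (hence on all of $[0,\bar r_\gamma]$ when $s>\bar r_\gamma$), where $w_\gamma$ is defined by $$B_\gamma=\gamma\left(1-\frac{2t_\gamma}{p_\gamma\gamma^{p_\gamma}}+\frac{w_\gamma}{\gamma^{p_\gamma}}\right):$$ $$B_\gamma\le\gamma,\qquad w_\gamma=O\left(\gamma^{-p_\gamma}t_\gamma\right),\qquad w_\gamma'=O\left(\gamma^{-p_\gamma}t_\gamma'\right),$$ and, for every fixed $\tilde\eta\in(\eta,1)$, $$\lambda_\gamma p_\gamma B_\gamma^{p_\gamma-1}e^{B_\gamma^{p_\gamma}}=\frac{8e^{-2t_\gamma}}{\mu_\gamma^2\gamma^{p_\gamma-1}p_\gamma}\left(1+O\left(\frac{e^{\tilde\eta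 t_\gamma}}{\gamma^{p_\gamma}}\right)\right).$$ The constants in the $O(\cdot)$'s, and the threshold beyond which $\gamma$ is large, do not depend on $r$, $s$ or $B_\gamma$; in the last estimate they may depend on $\tilde\eta$. -/

import Mathlib

namespace RadialBubble

/-- The Euclidean plane. -/
abbrev Plane : Type := EuclideanSpace ℝ (Fin 2)

/-- The radial profile `r ↦ f(r)` of a function on the plane, read along the first coordinate axis.
For a radially symmetric `f` and `r ≥ 0` this is the common value of `f` on `‖x‖ = r`. -/
noncomputable def radial (f : Plane → ℝ) (r : ℝ) : ℝ :=
  f (r • EuclideanSpace.single 0 1)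

/-- The number `λ` determined by `λ p² γ^{2(p-1)} μ² e^{γ^p} = 8`. -/
noncomputable def lam (p μ γ : ℝ) : ℝ :=
  8 / (p ^ 2 * γ ^ (2 * (p - 1)) * μ ^ 2 * Real.exp (γ ^ p))

theorem eq_lam_iff {p μ γ : ℝ} (hp : 0 < p) (hμ : 0 < μ) (hγ : 0 < γ) (l : ℝ) :
    l = lam p μ γ ↔ l * p ^ 2 * γ ^ (2 * (p - 1)) * μ ^ 2 * Real.exp (γ ^ p) = 8 := by
  have h : 0 < p ^ 2 * γ ^ (2 * (p - 1)) * μ ^ 2 * Real.exp (γ ^ p) := by positivity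
  rw [lam, eq_div_iff h.ne']
  constructor <;> intro h <;> linarith

/-- `t(x) = ln (1 + |x|² / μ²)`. -/
noncomputable def t (μ : ℝ) (x : Plane) : ℝ :=
  Real.log (1 + ‖x‖ ^ 2 / μ ^ 2)

/-- The nonlinearity `l p u^{p-1} e^{u^p}`. -/
noncomputable def nonlin (p l u : ℝ) : ℝ :=
  l * p * u ^ (p - 1) * Real.exp (u ^ p)

/-- `B` is, in the open disk of radius `s` around `0`, a positive radially symmetric classical
solution of `-(∂ₓₓ + ∂ᵧᵧ) B + h₀ B = l p B^{p-1} e^{B^p}` with `B(0) = γ`.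
(Mathlib's Laplacian is `∂ₓₓ + ∂ᵧᵧ`.) -/
structure IsBubble (h₀ p l γ s : ℝ) (B : Plane → ℝ) : Prop where
  radius_pos : 0 < s
  contDiffOn : ContDiffOn ℝ 2 B (Metric.ball 0 s)
  symmetric : ∀ x ∈ Metric.ball (0 : Plane) s, ∀ y ∈ Metric.ball (0 : Plane) s,
    ‖x‖ = ‖y‖ → B x = B y
  pos : ∀ x ∈ Metric.ball (0 : Plane) s, 0 < B x
  equation : ∀ x ∈ Metric.ball (0 : Plane) s,
    -(Laplacian.laplacian B x) + h₀ * B x = nonlin p l (B x)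
  center : B 0 = γ

/-- The remainder `w` in `B = γ (1 - 2 t / (p γ^p) + w / γ^p)`. -/
noncomputable def w (p μ γ : ℝ) (B : Plane → ℝ) (x : Plane) : ℝ :=
  γ ^ p * (B x / γ - 1 + 2 * t μ x / (p * γ ^ p))

theorem eq_w_iff {p μ γ : ℝ} (hγ : 0 < γ) (B : Plane → ℝ) (x : Plane) (v : ℝ) :
    v = w p μ γ B x ↔ B x = γ * (1 - 2 * t μ x / (p * γ ^ p) + v / γ ^ p) := by
  have h : 0 < γ ^ p := by positivity
  unfold w
  generalize 2 * t μ x / (p * γ ^ p) = a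
  constructor
  · rintro rfl
    field_simp
    ring
  · intro hB
    rw [hB]
    field_simp
    ring

end RadialBubble

/-! Write N = γ^p, τ = t(r), y = B/γ and F = y^(p-1) e^{N(y^p-1)+2τ}. Since (r τ')' = (4r/μ²)
e^{-2τ}, the profile -2τ/p solves the Liouville equation that is the formal limit of the problem.
Subtracting it leaves for the remainder (r w')' = h₀ N y r - (8r/(pμ²)) e^{-2τ} (F - 1)
(`IsBubble.flux_eq`).

The exponent in F equals N E + p w, where E is the second-order Taylor remainder of y ↦ y^p at 1.
Convexity and the bound τ ≤ ηpN/2 give 0 ≤ N E ≤ ητ + 3|w|. As long as w is small against 1 + τ,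
`abs_rescaled_nonlin_sub_one_le` therefore bounds F - 1 by e^{η'τ+1}((2τ+4τ²)/N + 6|w|) with η' < 1,
and one factor e^{-τ} of the equation still beats this growth.

The coefficient of |w| is not small, so a Gronwall argument is needed. `exists_weight` supplies a
bounded increasing G(τ) for which the flux 2k(1-e^{-τ})G(τ), with k of order 1/N, grows fast enough
to dominate the whole nonlinear term. Two integrations and a continuity argument
(`bounds_of_flux_le_of_small`) give |w| ≤ kτG + h₀Nr²/2 and the matching bound on w'. The h₀-term is
harmless because N²(μ²+r²) is bounded and r² ≤ (μ²+r²)τ. This is `apriori`, uniform in the bubble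
and its disk.

For existence, the nonlinearity is truncated to a compactly supported C¹ function and the radial
equation is solved globally in ρ = |x|² by a contraction. The a priori bounds keep the solution
strictly inside the range where the truncation is inactive, so it is a bubble past the prescribed
radius. The expansion of the nonlinearity is the estimate on F - 1 with the final bound on w
inserted. -/

namespace RadialBubble

open Filter Topology

/-! ### Second derivatives along lines and the equation in polar coordinates. -/

theorem hasDerivAt_deriv_of_contDiffAt {φ : ℝ → ℝ} {r : ℝ} (h : ContDiffAt ℝ 2 φ r) :
    HasDerivAt (deriv φ) (deriv (deriv φ) r) r := by
  have h1 : DifferentiableAt ℝ (fderiv ℝ φ) r :=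
    (h.fderiv_right (m := 1) (by norm_num)).differentiableAt (by simp)
  have h2 : deriv φ = fun q => fderiv ℝ φ q 1 := by
    funext q; rw [fderiv_apply_one_eq_deriv]
  have h3 : DifferentiableAt ℝ (deriv φ) r := by
    rw [h2]; exact h1.clm_apply (differentiableAt_const _)
  exact h3.hasDerivAt

/-- The first derivative along a line of a `C²` function. -/
theorem eventually_hasDerivAt_line {f : Plane → ℝ} {x : Plane} (hf : ContDiffAt ℝ 2 f x)
    (v : Plane) :
    ∀ᶠ s : ℝ in 𝓝 0, HasDerivAt (fun s : ℝ => f (x + s • v)) (fderiv ℝ f (x + s • v) v) s := by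
  have h1 : ∀ᶠ y in 𝓝 x, DifferentiableAt ℝ f y :=
    (hf.eventually (by simp)).mono fun y hy => hy.differentiableAt (by simp)
  have hc : Tendsto (fun s : ℝ => x + s • v) (𝓝 0) (𝓝 x) := by
    have : Continuous (fun s : ℝ => x + s • v) := by fun_prop
    simpa using this.tendsto 0
  filter_upwards [hc.eventually h1] with s hs
  have hl : HasDerivAt (fun s : ℝ => x + s • v) v s := by
    simpa using ((hasDerivAt_id s).smul_const v).const_add x
  exact hs.hasFDerivAt.comp_hasDerivAt s hl

/-- The second derivative along a line of a `C²` function. -/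
theorem hasDerivAt_deriv_line {f : Plane → ℝ} {x : Plane} (hf : ContDiffAt ℝ 2 f x)
    (v : Plane) :
    HasDerivAt (fun s : ℝ => fderiv ℝ f (x + s • v) v) (fderiv ℝ (fderiv ℝ f) x v v) 0 := by
  have h1 : DifferentiableAt ℝ (fderiv ℝ f) x :=
    (hf.fderiv_right (m := 1) (by norm_num)).differentiableAt (by simp)
  have hl : HasDerivAt (fun s : ℝ => x + s • v) v 0 := by
    simpa using ((hasDerivAt_id (0 : ℝ)).smul_const v).const_add x
  have h2 : HasFDerivAt (fderiv ℝ f) (fderiv ℝ (fderiv ℝ f) x) (x + (0 : ℝ) • v) := by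
    simpa using h1.hasFDerivAt
  have h3 := h2.comp_hasDerivAt (0 : ℝ) hl
  simpa using h3.clm_apply (hasDerivAt_const (0 : ℝ) v)

/-- If the derivative along the line through `x` is `g` near `0` and `g` has derivative `c` at `0`,
then `c` is the second derivative in that direction. -/
theorem fderiv_fderiv_apply_of_line {f : Plane → ℝ} {x : Plane} (hf : ContDiffAt ℝ 2 f x)
    (v : Plane) {g : ℝ → ℝ} {c : ℝ}
    (h : ∀ᶠ s : ℝ in 𝓝 0, HasDerivAt (fun s : ℝ => f (x + s • v)) (g s) s)
    (hg : HasDerivAt g c 0) : fderiv ℝ (fderiv ℝ f) x v v = c := by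
  have h1 : g =ᶠ[𝓝 0] fun s : ℝ => fderiv ℝ f (x + s • v) v := by
    filter_upwards [h, eventually_hasDerivAt_line hf v] with s h1 h2
    exact h1.unique h2
  exact (hasDerivAt_deriv_line hf v).unique (hg.congr_of_eventuallyEq h1.symm)

theorem laplacian_eq_fderiv_fderiv (f : Plane → ℝ) (x : Plane) :
    Laplacian.laplacian f x =
      fderiv ℝ (fderiv ℝ f) x (EuclideanSpace.single 0 1) (EuclideanSpace.single 0 1) +
      fderiv ℝ (fderiv ℝ f) x (EuclideanSpace.single 1 1) (EuclideanSpace.single 1 1) := by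
  rw [InnerProductSpace.laplacian_eq_iteratedFDeriv_orthonormalBasis f
    (EuclideanSpace.basisFun (Fin 2) ℝ)]
  simp [Fin.sum_univ_two, iteratedFDeriv_two_apply]

theorem norm_smul_single (r : ℝ) : ‖r • (EuclideanSpace.single 0 1 : Plane)‖ = |r| := by
  simp [norm_smul]

theorem norm_sq_eq (x : Plane) : ‖x‖ ^ 2 = x 0 ^ 2 + x 1 ^ 2 := by
  rw [EuclideanSpace.norm_sq_eq]; simp [Fin.sum_univ_two]

theorem norm_sq_add_smul_single (x : Plane) (s : ℝ) (i : Fin 2) :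
    ‖x + s • (EuclideanSpace.single i 1 : Plane)‖ ^ 2 = ‖x‖ ^ 2 + 2 * x i * s + s ^ 2 := by
  fin_cases i <;> simp [norm_sq_eq] <;> ring

theorem radial_t (μ r : ℝ) : radial (t μ) r = Real.log (1 + r ^ 2 / μ ^ 2) := by
  simp [radial, t, norm_smul]

section Radial

variable {h₀ p l γ s : ℝ} {B : Plane → ℝ}

theorem smul_single_mem_ball {r : ℝ} (hr : |r| < s) :
    r • (EuclideanSpace.single 0 1 : Plane) ∈ Metric.ball (0 : Plane) s := by
  rw [mem_ball_zero_iff, norm_smul_single]; exact hr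

theorem IsBubble.contDiffAt (hB : IsBubble h₀ p l γ s B) {x : Plane}
    (hx : x ∈ Metric.ball (0 : Plane) s) : ContDiffAt ℝ 2 B x :=
  hB.contDiffOn.contDiffAt (Metric.isOpen_ball.mem_nhds hx)

theorem IsBubble.radial_contDiffAt (hB : IsBubble h₀ p l γ s B) {r : ℝ} (hr : |r| < s) :
    ContDiffAt ℝ 2 (radial B) r := by
  have h1 : ContDiffAt ℝ 2 (fun r : ℝ => r • (EuclideanSpace.single 0 1 : Plane)) r := by
    fun_prop
  exact (hB.contDiffAt (smul_single_mem_ball hr)).comp r h1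

theorem IsBubble.radial_zero (hB : IsBubble h₀ p l γ s B) : radial B 0 = γ := by
  simp [radial, hB.center]

theorem IsBubble.radial_pos (hB : IsBubble h₀ p l γ s B) {r : ℝ} (hr : |r| < s) :
    0 < radial B r := hB.pos _ (smul_single_mem_ball hr)

theorem IsBubble.eq_radial (hB : IsBubble h₀ p l γ s B) {x : Plane} {r : ℝ} (hx : ‖x‖ = |r|)
    (hr : |r| < s) : B x = radial B r := by
  refine hB.symmetric _ ?_ _ (smul_single_mem_ball hr) ?_
  · rw [mem_ball_zero_iff, hx]; exact hr
  · rw [hx, norm_smul_single]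

theorem IsBubble.radial_neg (hB : IsBubble h₀ p l γ s B) {r : ℝ} (hr : |r| < s) :
    radial B (-r) = radial B r :=
  hB.eq_radial (by rw [norm_smul_single, abs_neg]) hr

theorem IsBubble.deriv_radial_zero (hB : IsBubble h₀ p l γ s B) : deriv (radial B) 0 = 0 := by
  have h0 : |(0 : ℝ)| < s := by simpa using hB.radius_pos
  have h1 : HasDerivAt (radial B) (deriv (radial B) 0) 0 :=
    ((hB.radial_contDiffAt h0).differentiableAt (by simp)).hasDerivAt
  have h1' : HasDerivAt (radial B) (deriv (radial B) 0) (-0) := by simpa using h1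
  have h2 : HasDerivAt (fun r => radial B (-r)) (deriv (radial B) 0 * -1) 0 :=
    h1'.comp 0 (hasDerivAt_neg (0 : ℝ))
  have h3 : (fun r => radial B (-r)) =ᶠ[𝓝 0] radial B := by
    have : ∀ᶠ r : ℝ in 𝓝 0, |r| < s := continuous_abs.continuousAt.eventually_lt
      continuousAt_const h0
    exact this.mono fun r hr => hB.radial_neg hr
  have h4 := (h2.congr_of_eventuallyEq h3.symm).unique h1
  linarith

/-- The equation of a bubble in polar coordinates. -/
theorem IsBubble.radial_equation (hB : IsBubble h₀ p l γ s B) {r : ℝ} (hr0 : 0 < r)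
    (hrs : r < s) :
    deriv (deriv (radial B)) r + deriv (radial B) r / r =
      h₀ * radial B r - nonlin p l (radial B r) := by
  have hr : |r| < s := by rwa [abs_of_pos hr0]
  set x : Plane := r • (EuclideanSpace.single 0 1 : Plane) with hx
  have hxm : x ∈ Metric.ball (0 : Plane) s := smul_single_mem_ball hr
  have hc := hB.contDiffAt hxm
  have heq := hB.equation x hxm
  have hφ : ∀ᶠ q in 𝓝 r, HasDerivAt (radial B) (deriv (radial B) q) q :=
    ((hB.radial_contDiffAt hr).eventually (by simp)).mono fun q hq =>
      (hq.differentiableAt (by simp)).hasDerivAt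
  have hφ2 : HasDerivAt (deriv (radial B)) (deriv (deriv (radial B)) r) r :=
    hasDerivAt_deriv_of_contDiffAt (hB.radial_contDiffAt hr)
  have e0 : fderiv ℝ (fderiv ℝ B) x (EuclideanSpace.single 0 1) (EuclideanSpace.single 0 1) =
      deriv (deriv (radial B)) r := by
    have hfun : (fun q : ℝ => B (x + q • (EuclideanSpace.single 0 1 : Plane))) =
        fun q => radial B (r + q) := by
      funext q; simp [radial, hx, add_smul]
    have htend : Tendsto (fun q : ℝ => r + q) (𝓝 0) (𝓝 r) := by
      have : Continuous fun q : ℝ => r + q := by fun_prop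
      simpa using this.tendsto 0
    refine fderiv_fderiv_apply_of_line hc _ (g := fun q => deriv (radial B) (r + q)) ?_ ?_
    · rw [hfun]
      filter_upwards [htend.eventually hφ] with q hq
      exact hq.comp_const_add r q
    · exact HasDerivAt.comp_const_add r 0 (by simpa using hφ2)
  -- A tangential displacement q changes the radius to √(r²+q²), hence only to second order; this is
  -- why a first derivative of the profile, divided by r, is all that remains.
  have e1 : fderiv ℝ (fderiv ℝ B) x (EuclideanSpace.single 1 1) (EuclideanSpace.single 1 1) =
      deriv (radial B) r / r := by
    have hn : ∀ q : ℝ, ‖x + q • (EuclideanSpace.single 1 1 : Plane)‖ = √(r ^ 2 + q ^ 2) := by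
      intro q
      rw [← Real.sqrt_sq (norm_nonneg (x + q • (EuclideanSpace.single 1 1 : Plane))),
        norm_sq_add_smul_single]
      simp [hx, norm_smul]
    have hcont : Continuous fun q : ℝ => √(r ^ 2 + q ^ 2) := by fun_prop
    have htend : Tendsto (fun q : ℝ => √(r ^ 2 + q ^ 2)) (𝓝 0) (𝓝 r) := by
      simpa [Real.sqrt_sq hr0.le] using hcont.tendsto 0
    have hfun : (fun q : ℝ => B (x + q • (EuclideanSpace.single 1 1 : Plane))) =ᶠ[𝓝 0]
        fun q => radial B √(r ^ 2 + q ^ 2) := by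
      filter_upwards [htend.eventually (gt_mem_nhds hrs)] with q hq
      refine hB.eq_radial ?_ ?_
      · rw [hn, abs_of_nonneg (Real.sqrt_nonneg _)]
      · rwa [abs_of_nonneg (Real.sqrt_nonneg _)]
    have hpos : ∀ q : ℝ, 0 < r ^ 2 + q ^ 2 := fun q => by positivity
    have hsq : ∀ q : ℝ, HasDerivAt (fun q : ℝ => √(r ^ 2 + q ^ 2)) (q / √(r ^ 2 + q ^ 2)) q := by
      intro q
      have h1 : HasDerivAt (fun q : ℝ => r ^ 2 + q ^ 2) (2 * q) q := by
        simpa using (hasDerivAt_pow 2 q).const_add (r ^ 2)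
      convert h1.sqrt (hpos q).ne' using 1
      have := Real.sqrt_pos.2 (hpos q)
      field_simp
    refine fderiv_fderiv_apply_of_line hc _
      (g := fun q => deriv (radial B) √(r ^ 2 + q ^ 2) * (q / √(r ^ 2 + q ^ 2))) ?_ ?_
    · filter_upwards [hfun.eventually_nhds, htend.eventually hφ] with q hq1 hq2
      exact HasDerivAt.congr_of_eventuallyEq (hq2.comp (h₂ := radial B) q (hsq q)) hq1
    · have hs0 : √(r ^ 2 + (0 : ℝ) ^ 2) = r := by simp [Real.sqrt_sq hr0.le]
      have h1 : HasDerivAt (fun q : ℝ => deriv (radial B) √(r ^ 2 + q ^ 2))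
          (deriv (deriv (radial B)) r * (0 / √(r ^ 2 + (0 : ℝ) ^ 2))) 0 := by
        refine HasDerivAt.comp (h₂ := deriv (radial B)) (0 : ℝ) ?_ (hsq 0)
        rw [hs0]; exact hφ2
      have h2 : HasDerivAt (fun q : ℝ => q / √(r ^ 2 + q ^ 2)) (1 / r) 0 := by
        refine ((hasDerivAt_id (0 : ℝ)).fun_div (hsq 0)
          (by rw [hs0]; exact hr0.ne')).congr_deriv ?_
        rw [hs0]
        have := hr0.ne'
        simp only [id]
        field_simp
        ring
      refine (h1.fun_mul h2).congr_deriv ?_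
      rw [hs0]; simp [div_eq_mul_inv]
  rw [laplacian_eq_fderiv_fderiv, e0, e1] at heq
  have : radial B r = B x := rfl
  rw [this]
  linarith

end Radial

/-- The Laplacian of a function of `‖x‖²`. -/
theorem laplacian_comp_norm_sq {f : ℝ → ℝ} (hf : ContDiff ℝ 2 f) (x : Plane) :
    Laplacian.laplacian (fun y : Plane => f (‖y‖ ^ 2)) x =
      4 * deriv f (‖x‖ ^ 2) + 4 * ‖x‖ ^ 2 * deriv (deriv f) (‖x‖ ^ 2) := by
  have hc : ContDiff ℝ 2 (fun y : Plane => f (‖y‖ ^ 2)) := hf.comp (contDiff_norm_sq ℝ)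
  have hf1 : ∀ q, HasDerivAt f (deriv f q) q := fun q =>
    (hf.differentiable (by simp) q).hasDerivAt
  have hf2 : ∀ q, HasDerivAt (deriv f) (deriv (deriv f) q) q := fun q =>
    ((hf.iterate_deriv' 1 1).differentiable (by simp) q).hasDerivAt
  have key : ∀ i : Fin 2, fderiv ℝ (fderiv ℝ (fun y : Plane => f (‖y‖ ^ 2))) x
      (EuclideanSpace.single i 1) (EuclideanSpace.single i 1) =
      deriv (deriv f) (‖x‖ ^ 2) * (2 * x i) * (2 * x i) + deriv f (‖x‖ ^ 2) * 2 := by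
    intro i
    have hq : ∀ q : ℝ, HasDerivAt (fun q => ‖x‖ ^ 2 + 2 * x i * q + q ^ 2) (2 * x i + 2 * q) q := by
      intro q
      have h1 : HasDerivAt (fun q => ‖x‖ ^ 2 + 2 * x i * q) (2 * x i) q := by
        simpa using ((hasDerivAt_id q).const_mul (2 * x i)).const_add (‖x‖ ^ 2)
      simpa using h1.fun_add (hasDerivAt_pow 2 q)
    refine fderiv_fderiv_apply_of_line hc.contDiffAt _
      (g := fun q => deriv f (‖x‖ ^ 2 + 2 * x i * q + q ^ 2) * (2 * x i + 2 * q)) ?_ ?_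
    · refine Eventually.of_forall fun q => ?_
      simp only [norm_sq_add_smul_single]
      exact (hf1 _).comp q (hq q)
    · have h1 : HasDerivAt (fun q => deriv f (‖x‖ ^ 2 + 2 * x i * q + q ^ 2))
          (deriv (deriv f) (‖x‖ ^ 2) * (2 * x i)) 0 := by
        have := (hf2 (‖x‖ ^ 2 + 2 * x i * 0 + 0 ^ 2)).comp (0 : ℝ) (hq 0)
        simpa [Function.comp_def] using this
      have h2 : HasDerivAt (fun q : ℝ => 2 * x i + 2 * q) 2 0 := by
        simpa using ((hasDerivAt_id (0 : ℝ)).const_mul 2).const_add (2 * x i)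
      simpa using h1.fun_mul h2
  rw [laplacian_eq_fderiv_fderiv, key, key, norm_sq_eq]
  ring

/-! ### Pointwise comparison of the nonlinearity with the Liouville profile. -/

theorem rpow_taylor_nonneg {p y : ℝ} (hp : 1 ≤ p) (hy : 0 ≤ y) : 0 ≤ y ^ p - 1 - p * (y - 1) := by
  have h := one_add_mul_self_le_rpow_one_add (s := y - 1) (by linarith) hp
  rw [add_sub_cancel] at h
  linarith

/-- Split y^p = y · y^(p-1) and use Bernoulli's inequality for the concave power p - 1 ∈ [0,1]. The
factor p - 1 matters: it is what later yields the growth rate η in the exponent. -/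
theorem rpow_taylor_le {p y : ℝ} (hp : p ∈ Set.Icc (1 : ℝ) 2) (hy : 0 < y) :
    y ^ p - 1 - p * (y - 1) ≤ (p - 1) * (y - 1) ^ 2 := by
  have h := rpow_one_add_le_one_add_mul_self (s := y - 1) (by linarith) (p := p - 1)
    (by linarith [hp.1]) (by linarith [hp.2])
  rw [add_sub_cancel] at h
  have h2 : y ^ p = y * y ^ (p - 1) := by
    rw [Real.rpow_sub_one hy.ne']; field_simp
  rw [h2]
  nlinarith [mul_le_mul_of_nonneg_left h hy.le]

theorem abs_rpow_sub_one_le {q y : ℝ} (hq : q ∈ Set.Icc (0 : ℝ) 1) (hy : 0 < y) :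
    |y ^ q - 1| ≤ |y - 1| := by
  rcases le_total y 1 with h | h
  · have h1 : y ≤ y ^ q := by
      simpa using Real.rpow_le_rpow_of_exponent_ge hy h hq.2
    have h2 : y ^ q ≤ 1 := Real.rpow_le_one hy.le h hq.1
    rw [abs_of_nonpos (by linarith), abs_of_nonpos (by linarith)]; linarith
  · have h1 : y ^ q ≤ y := by
      simpa using Real.rpow_le_rpow_of_exponent_le h hq.2
    have h2 : 1 ≤ y ^ q := Real.one_le_rpow h hq.1
    rw [abs_of_nonneg (by linarith), abs_of_nonneg (by linarith)]; linarith

theorem abs_exp_sub_one_le_mul_exp {z M : ℝ} (hz : z ≤ M) (hM : 0 ≤ M) :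
    |Real.exp z - 1| ≤ |z| * Real.exp M := by
  rcases le_total 0 z with h | h
  · have h1 : Real.exp z - 1 ≤ z * Real.exp z := by
      have h2 := Real.add_one_le_exp (-z)
      have h3 : Real.exp z * Real.exp (-z) = 1 := by rw [← Real.exp_add]; simp
      nlinarith [Real.exp_pos z]
    rw [abs_of_nonneg (by linarith [Real.add_one_le_exp z]), abs_of_nonneg h]
    exact h1.trans (mul_le_mul_of_nonneg_left (Real.exp_le_exp.2 hz) h)
  · have h1 : Real.exp z ≤ 1 := Real.exp_le_one_iff.2 h
    have h2 : 1 ≤ Real.exp M := Real.one_le_exp hM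
    rw [abs_of_nonpos (by linarith), abs_of_nonpos h]
    nlinarith [Real.add_one_le_exp z]

/-- Pointwise comparison of the rescaled nonlinearity at `y = 1 - 2 t / (p N) + w / N`
with `e ^ {-2 t}`. -/
theorem abs_rescaled_nonlin_sub_one_le {p N t w η η' ε y : ℝ} (hp : p ∈ Set.Icc (1 : ℝ) 2)
    (hN : 1 ≤ N) (ht : 0 ≤ t) (hη : η ∈ Set.Ioo (0 : ℝ) 1) (htN : t ≤ η * (p * N / 2))
    (hε : 0 < ε) (hε' : ε ≤ 1 / 6) (hη' : η + 6 * ε ≤ η') (hw : |w| ≤ ε * (1 + t))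
    (hy : y = 1 - 2 * t / (p * N) + w / N) (hy0 : 0 < y) :
    |y ^ (p - 1) * Real.exp (N * (y ^ p - 1) + 2 * t) - 1| ≤
      Real.exp (η' * t + 1) * ((2 * t + 4 * t ^ 2) / N + 6 * |w|) := by
  obtain ⟨hp1, hp2⟩ := hp
  obtain ⟨hη0, hη1⟩ := hη
  have hN0 : 0 < N := by linarith
  have hp0 : 0 < p := by linarith
  set T := 2 * t / p with hT
  have hT0 : 0 ≤ T := by positivity
  have hTN : T ≤ η * N := by
    rw [hT, div_le_iff₀ hp0]; linarith
  have hpT : p * T = 2 * t := by rw [hT]; field_simp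
  have hT2 : T ≤ 2 * t := by nlinarith
  have hyx : y - 1 = (w - T) / N := by
    rw [hy, hT]; field_simp; ring
  set E := y ^ p - 1 - p * (y - 1) with hE
  have hE0 : 0 ≤ E := rpow_taylor_nonneg hp1 hy0.le
  have hE1 : E ≤ (p - 1) * (y - 1) ^ 2 := rpow_taylor_le ⟨hp1, hp2⟩ hy0
  have ha0 := abs_nonneg w
  have htN' : t ≤ N := by nlinarith
  have hwN : |w| * |w| / N ≤ |w| := by
    rw [div_le_iff₀ hN0]
    refine mul_le_mul_of_nonneg_left ?_ ha0
    nlinarith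
  have hTN' : T ≤ N := by nlinarith
  have hTw : T * |w| / N ≤ |w| := by
    rw [div_le_iff₀ hN0, mul_comm]
    exact mul_le_mul_of_nonneg_left hTN' ha0
  have hsq : (w - T) ^ 2 / N ≤ T ^ 2 / N + 3 * |w| := by
    have h1 : (w - T) ^ 2 ≤ T ^ 2 + 2 * (T * |w|) + |w| * |w| := by
      have h2 : 0 ≤ T * (w + |w|) := mul_nonneg hT0 (by linarith [neg_abs_le w])
      have h3 := abs_mul_abs_self w
      linarith
    calc (w - T) ^ 2 / N ≤ (T ^ 2 + 2 * (T * |w|) + |w| * |w|) / N := by gcongr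
      _ = T ^ 2 / N + 2 * (T * |w| / N) + |w| * |w| / N := by ring
      _ ≤ _ := by linarith
  have hNE : N * E ≤ (p - 1) * (T ^ 2 / N) + 3 * |w| := by
    have h1 : N * E ≤ N * ((p - 1) * (y - 1) ^ 2) := mul_le_mul_of_nonneg_left hE1 hN0.le
    have h2 : N * ((p - 1) * (y - 1) ^ 2) = (p - 1) * ((w - T) ^ 2 / N) := by
      rw [hyx]; field_simp
    have h3 : (p - 1) * ((w - T) ^ 2 / N) ≤ (p - 1) * (T ^ 2 / N + 3 * |w|) :=
      mul_le_mul_of_nonneg_left hsq (by linarith)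
    have h4 : (p - 1) * |w| ≤ 1 * |w| := mul_le_mul_of_nonneg_right (by linarith) ha0
    linarith
  have hNE0 : 0 ≤ N * E := by positivity
  -- Two bounds on N E serve different ends. This one is linear in t with rate η < 1 and controls
  -- the exponential; `hNE2` carries the factor 1/N and measures the size of the error. Here (p-1)T
  -- ≤ t because pT = 2t and p ≤ 2.
  have hNE1 : N * E ≤ η * t + 3 * |w| := by
    have h1 : T ^ 2 / N ≤ η * T := by
      rw [div_le_iff₀ hN0]
      calc T ^ 2 = T * T := by ring
        _ ≤ (η * N) * T := mul_le_mul_of_nonneg_right hTN hT0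
        _ = _ := by ring
    have h2 : (p - 1) * (T ^ 2 / N) ≤ (p - 1) * (η * T) :=
      mul_le_mul_of_nonneg_left h1 (by linarith)
    have h3 : (p - 1) * T ≤ t := by
      have : 0 ≤ (2 - p) * T := mul_nonneg (by linarith) hT0
      linarith
    have h4 : η * ((p - 1) * T) ≤ η * t := mul_le_mul_of_nonneg_left h3 hη0.le
    linarith
  have hNE2 : N * E ≤ 4 * t ^ 2 / N + 3 * |w| := by
    have h1 : T ^ 2 / N ≤ 4 * t ^ 2 / N := by
      have h0 : T ^ 2 ≤ (2 * t) ^ 2 := pow_le_pow_left₀ hT0 hT2 2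
      gcongr; linarith
    have h2 : (p - 1) * (T ^ 2 / N) ≤ 1 * (T ^ 2 / N) :=
      mul_le_mul_of_nonneg_right (by linarith) (by positivity)
    linarith
  -- The first-order Taylor term is p(w - T), and pT = 2t cancels the added 2t.
  have hZ : N * (y ^ p - 1) + 2 * t = N * E + p * w := by
    have h1 : N * (y - 1) = w - T := by rw [hyx]; field_simp
    have h2 : y ^ p - 1 = E + p * (y - 1) := by rw [hE]; ring
    rw [h2]
    linear_combination p * h1 - hpT
  have hpw : |p * w| ≤ 2 * |w| := by
    rw [abs_mul, abs_of_pos hp0]; gcongr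
  have hM : N * E + p * w ≤ η' * t + 1 := by
    have h1 := le_abs_self (p * w)
    have h2 : (η + 6 * ε) * t ≤ η' * t := mul_le_mul_of_nonneg_right hη' ht
    have h3 : 0 ≤ ε * t := by positivity
    linarith
  have hM0 : 0 ≤ η' * t + 1 := by
    have : 0 ≤ η' := by linarith
    positivity
  have hx : |y - 1| ≤ 2 * t / N + |w| := by
    rw [hyx, abs_div, abs_of_pos hN0, div_le_iff₀ hN0, add_mul, div_mul_cancel₀ _ hN0.ne']
    have h1 := abs_sub w T
    rw [abs_of_nonneg hT0] at h1
    have h2 : |w| * 1 ≤ |w| * N := mul_le_mul_of_nonneg_left hN ha0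
    linarith
  rw [hZ]
  have h1 : |y ^ (p - 1) - 1| ≤ |y - 1| :=
    abs_rpow_sub_one_le ⟨by linarith, by linarith⟩ hy0
  have h2 : |Real.exp (N * E + p * w) - 1| ≤ |N * E + p * w| * Real.exp (η' * t + 1) :=
    abs_exp_sub_one_le_mul_exp hM hM0
  have h3 : |N * E + p * w| ≤ N * E + 2 * |w| := by
    refine (abs_add_le _ _).trans ?_
    rw [abs_of_nonneg hNE0]; linarith
  have h4 : Real.exp (N * E + p * w) ≤ Real.exp (η' * t + 1) := Real.exp_le_exp.2 hM
  have h5 : 0 < Real.exp (η' * t + 1) := Real.exp_pos _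
  calc |y ^ (p - 1) * Real.exp (N * E + p * w) - 1|
      = |(y ^ (p - 1) - 1) * Real.exp (N * E + p * w) + (Real.exp (N * E + p * w) - 1)| := by
        congr 1; ring
    _ ≤ |y ^ (p - 1) - 1| * Real.exp (N * E + p * w) + |Real.exp (N * E + p * w) - 1| := by
        refine (abs_add_le _ _).trans ?_
        rw [abs_mul, abs_of_pos (Real.exp_pos (N * E + p * w))]
    _ ≤ (2 * t / N + |w|) * Real.exp (η' * t + 1) +
          (4 * t ^ 2 / N + 3 * |w| + 2 * |w|) * Real.exp (η' * t + 1) := by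
        refine add_le_add ?_ ?_
        · exact mul_le_mul (h1.trans hx) h4 (Real.exp_pos _).le (by positivity)
        · exact h2.trans (mul_le_mul_of_nonneg_right (by linarith) h5.le)
    _ = _ := by ring

/-! ### The Gronwall weight and the integration of the flux inequality. -/

/-- A bounded increasing weight whose associated flux absorbs the linearised nonlinearity. -/
theorem exists_weight {a C : ℝ} (ha : 0 < a) (ha1 : a ≤ 1) (hC : 1 ≤ C) :
    ∃ (G G' : ℝ → ℝ) (A : ℝ), (∀ t, HasDerivAt G (G' t) t) ∧ (∀ t, 0 ≤ G' t) ∧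
      (∀ t, 0 ≤ t → 1 ≤ G t) ∧ (∀ t, G t ≤ A) ∧
      ∀ t, 0 ≤ t → C * Real.exp (-(a * t)) * (1 + t * G t) ≤
        Real.exp (-t) * G t + (1 - Real.exp (-t)) * G' t := by
  -- The weight is C exp(L(1 - e^{-bt})). Its logarithmic derivative L b e^{-bt} is integrable, so
  -- it stays bounded. Taking b = a/2 leaves room for e^{-at}(1+bt) ≤ e^{-bt}, and L is chosen so
  -- that L b² = C + 1. The prefactor C ensures C(1+tG) ≤ (1+Ct)G.
  set b := a / 2 with hb
  have hb0 : 0 < b := by positivity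
  set L := (C + 1) / b ^ 2 with hL
  have hL0 : 0 < L := by positivity
  have hLb : L * b * b = C + 1 := by rw [hL]; field_simp
  refine ⟨fun t => C * Real.exp (L * (1 - Real.exp (-(b * t)))),
    fun t => C * Real.exp (L * (1 - Real.exp (-(b * t)))) * (L * b * Real.exp (-(b * t))),
    C * Real.exp L, ?_, ?_, ?_, ?_, ?_⟩
  · intro t
    have h1 : HasDerivAt (fun t : ℝ => -(b * t)) (-b) t := by
      simpa using ((hasDerivAt_id t).const_mul b).fun_neg
    have h2 := (((h1.exp.const_sub 1).const_mul L).exp).const_mul C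
    refine h2.congr_deriv ?_
    ring
  · intro t; positivity
  · intro t ht
    have h1 : Real.exp (-(b * t)) ≤ 1 := Real.exp_le_one_iff.2 (by nlinarith)
    have h2 : 1 ≤ Real.exp (L * (1 - Real.exp (-(b * t)))) :=
      Real.one_le_exp (mul_nonneg hL0.le (by linarith))
    nlinarith
  · intro t
    have h1 : L * (1 - Real.exp (-(b * t))) ≤ L := by nlinarith [Real.exp_pos (-(b * t))]
    have := Real.exp_le_exp.2 h1
    show C * _ ≤ _
    gcongr
  · intro t ht
    set g := C * Real.exp (L * (1 - Real.exp (-(b * t)))) with hg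
    have hgC : C ≤ g := by
      have h1 : Real.exp (-(b * t)) ≤ 1 := Real.exp_le_one_iff.2 (by nlinarith)
      have h2 : 1 ≤ Real.exp (L * (1 - Real.exp (-(b * t)))) :=
        Real.one_le_exp (mul_nonneg hL0.le (by linarith))
      nlinarith
    have hg0 : 0 < g := by linarith
    set d := 1 - Real.exp (-t) with hd
    have hd0 : 0 ≤ d := by
      have : Real.exp (-t) ≤ 1 := Real.exp_le_one_iff.2 (by linarith)
      linarith
    have hd1 : t ≤ d * (1 + t) := by
      have h1 := Real.add_one_le_exp t
      have h2 : Real.exp (-t) * Real.exp t = 1 := by rw [← Real.exp_add]; simp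
      have h3 := Real.exp_pos (-t)
      nlinarith
    have he := Real.exp_pos (-(a * t))
    have h1 : Real.exp (-(a * t)) * (1 - d) ≤ Real.exp (-t) := by
      have h2 : Real.exp (-(a * t)) ≤ 1 := Real.exp_le_one_iff.2 (by nlinarith)
      have h3 : 1 - d = Real.exp (-t) := by rw [hd]; ring
      rw [h3]; nlinarith [Real.exp_pos (-t)]
    have h2 : Real.exp (-(a * t)) * (1 + b * t) ≤ Real.exp (-(b * t)) := by
      have h3 : Real.exp (-(b * t)) = Real.exp (-(a * t)) * Real.exp (b * t) := by
        rw [← Real.exp_add]; congr 1; rw [hb]; ring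
      rw [h3]
      refine mul_le_mul_of_nonneg_left ?_ he.le
      linarith [Real.add_one_le_exp (b * t)]
    have hb1 : b ≤ 1 := by rw [hb]; linarith
    have h3 : (C + 1) * (1 + t) ≤ L * b * (1 + b * t) := by
      have h4 : b * (1 + t) ≤ 1 + b * t := by nlinarith
      have h5 : L * b * (b * (1 + t)) ≤ L * b * (1 + b * t) :=
        mul_le_mul_of_nonneg_left h4 (by positivity)
      calc (C + 1) * (1 + t) = L * b * (b * (1 + t)) := by rw [← hLb]; ring
        _ ≤ _ := h5
    -- The coefficient d of G' vanishes at t = 0, so the constant 1 is split as (1-d) + d, and the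
    -- linear term is moved onto d through t ≤ d(1+t).
    have h4 : 1 + C * t ≤ (1 - d) + d * (L * b * (1 + b * t)) := by
      have h5 : d * ((C + 1) * (1 + t)) ≤ d * (L * b * (1 + b * t)) :=
        mul_le_mul_of_nonneg_left h3 hd0
      nlinarith
    have h5 : Real.exp (-(a * t)) * (1 + C * t) ≤
        Real.exp (-t) + d * (L * b * Real.exp (-(b * t))) := by
      have h6 := mul_le_mul_of_nonneg_left h4 he.le
      have h7 : d * (L * b) * (Real.exp (-(a * t)) * (1 + b * t)) ≤
          d * (L * b) * Real.exp (-(b * t)) := mul_le_mul_of_nonneg_left h2 (by positivity)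
      nlinarith
    calc C * Real.exp (-(a * t)) * (1 + t * g)
        ≤ Real.exp (-(a * t)) * (1 + C * t) * g := by
          nlinarith [mul_nonneg he.le (sub_nonneg.2 hgC)]
      _ ≤ (Real.exp (-t) + d * (L * b * Real.exp (-(b * t)))) * g :=
          mul_le_mul_of_nonneg_right h5 hg0.le
      _ = _ := by ring

theorem one_add_div_sq {μ : ℝ} (hμ : 0 < μ) (r : ℝ) :
    1 + r ^ 2 / μ ^ 2 = (μ ^ 2 + r ^ 2) / μ ^ 2 := by field_simp

theorem radial_t_nonneg {μ : ℝ} (r : ℝ) : 0 ≤ radial (t μ) r := by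
  have : 0 ≤ r ^ 2 / μ ^ 2 := by positivity
  rw [radial_t]
  exact Real.log_nonneg (by linarith)

theorem exp_neg_radial_t {μ : ℝ} (hμ : 0 < μ) (r : ℝ) :
    Real.exp (-radial (t μ) r) = μ ^ 2 / (μ ^ 2 + r ^ 2) := by
  rw [radial_t, Real.exp_neg, Real.exp_log (by positivity), one_add_div_sq hμ, inv_div]

theorem hasDerivAt_radial_t {μ : ℝ} (hμ : 0 < μ) (r : ℝ) :
    HasDerivAt (radial (t μ)) (2 * r / (μ ^ 2 + r ^ 2)) r := by
  have h : radial (t μ) = fun r => Real.log (1 + r ^ 2 / μ ^ 2) := funext (radial_t μ)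
  rw [h]
  have h1 : HasDerivAt (fun r : ℝ => 1 + r ^ 2 / μ ^ 2) (2 * r / μ ^ 2) r := by
    simpa using ((hasDerivAt_pow 2 r).div_const (μ ^ 2)).const_add 1
  refine (h1.log (by positivity)).congr_deriv ?_
  rw [one_add_div_sq hμ]
  field_simp

theorem radial_t_mono {μ r q : ℝ} (hμ : 0 < μ) (hr : 0 ≤ r) (hrq : r ≤ q) :
    radial (t μ) r ≤ radial (t μ) q := by
  rw [radial_t, radial_t]
  gcongr

/-- `r² ≤ (μ² + r²) t(r)`. -/
theorem sq_le_mul_radial_t {μ : ℝ} (hμ : 0 < μ) (r : ℝ) :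
    r ^ 2 ≤ (μ ^ 2 + r ^ 2) * radial (t μ) r := by
  have h1 := Real.add_one_le_exp (-radial (t μ) r)
  rw [exp_neg_radial_t hμ, le_div_iff₀ (by positivity)] at h1
  linarith

/-- A function vanishing at `0` whose derivative is dominated by that of `P` is dominated by
`P`. -/
theorem abs_le_of_abs_deriv_le {f f' P P' : ℝ → ℝ} {R : ℝ}
    (hf : ∀ r ∈ Set.Icc 0 R, HasDerivAt f (f' r) r)
    (hP : ∀ r ∈ Set.Icc 0 R, HasDerivAt P (P' r) r) (hf0 : f 0 = 0) (hP0 : P 0 = 0)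
    (h : ∀ r ∈ Set.Ioo 0 R, |f' r| ≤ P' r) {r : ℝ} (hr : r ∈ Set.Icc 0 R) : |f r| ≤ P r := by
  have h0 : (0 : ℝ) ∈ Set.Icc 0 R := ⟨le_rfl, hr.1.trans hr.2⟩
  have key : ∀ σ : ℝ, |σ| = 1 → σ * f r ≤ P r := by
    intro σ hσ
    have hd : ∀ q ∈ Set.Icc 0 R, HasDerivAt (fun q => P q - σ * f q) (P' q - σ * f' q) q :=
      fun q hq => (hP q hq).fun_sub ((hf q hq).const_mul σ)
    have hm : MonotoneOn (fun q => P q - σ * f q) (Set.Icc 0 R) := by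
      refine monotoneOn_of_deriv_nonneg (convex_Icc 0 R)
        (fun q hq => (hd q hq).continuousAt.continuousWithinAt) ?_ ?_
      · intro q hq
        rw [interior_Icc] at hq
        exact (hd q ⟨hq.1.le, hq.2.le⟩).differentiableAt.differentiableWithinAt
      · intro q hq
        rw [interior_Icc] at hq
        rw [(hd q ⟨hq.1.le, hq.2.le⟩).deriv]
        have h1 := h q hq
        have h2 : σ * f' q ≤ |f' q| := by
          calc σ * f' q ≤ |σ * f' q| := le_abs_self _
            _ = |f' q| := by rw [abs_mul, hσ, one_mul]
        linarith
    have h3 := hm h0 hr hr.1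
    simp only [hf0, hP0] at h3
    linarith
  rw [abs_le]
  have h1 := key 1 (by simp)
  have h2 := key (-1) (by simp)
  constructor <;> linarith

section Bootstrap

variable {μ k H R : ℝ} {G G' w w' w'' : ℝ → ℝ}

/-- Integration of the flux inequality, twice. -/
theorem bounds_of_flux_le (hμ : 0 < μ) (hk : 0 < k)
    (hG : ∀ t, HasDerivAt G (G' t) t) (hG' : ∀ t, 0 ≤ G' t)
    (hw : ∀ r ∈ Set.Icc 0 R, HasDerivAt w (w' r) r)
    (hw' : ∀ r ∈ Set.Icc 0 R, HasDerivAt w' (w'' r) r) (hw0 : w 0 = 0)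
    (h : ∀ r ∈ Set.Ioo 0 R, |w' r + r * w'' r| ≤
      4 * r / μ ^ 2 * Real.exp (-radial (t μ) r) *
        (k * (Real.exp (-radial (t μ) r) * G (radial (t μ) r) +
          (1 - Real.exp (-radial (t μ) r)) * G' (radial (t μ) r))) + 2 * H * r) :
    (∀ r ∈ Set.Ioc 0 R, |w' r| ≤ k * G (radial (t μ) r) * (2 * r / (μ ^ 2 + r ^ 2)) + H * r) ∧
    (∀ r ∈ Set.Icc 0 R, |w r| ≤ k * (radial (t μ) r * G (radial (t μ) r)) + H * r ^ 2 / 2) := by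
  have ht := hasDerivAt_radial_t hμ
  have hGt : ∀ r, HasDerivAt (fun r => G (radial (t μ) r))
      (G' (radial (t μ) r) * (2 * r / (μ ^ 2 + r ^ 2))) r := fun r => (hG _).comp r (ht r)
  have h1 : ∀ r ∈ Set.Ioc 0 R,
      |w' r| ≤ k * G (radial (t μ) r) * (2 * r / (μ ^ 2 + r ^ 2)) + H * r := by
    intro r hr
    -- The assumed bound is an exact derivative: (4q/μ²)e^{-τ} = 2τ', and e^{-τ}G + (1-e^{-τ})G' is
    -- the τ-derivative of (1-e^{-τ})G.
    have hP : ∀ q ∈ Set.Icc 0 R, HasDerivAt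
        (fun q => k * (2 * (1 - Real.exp (-radial (t μ) q))) * G (radial (t μ) q) + H * q ^ 2)
        (4 * q / μ ^ 2 * Real.exp (-radial (t μ) q) *
        (k * (Real.exp (-radial (t μ) q) * G (radial (t μ) q) +
          (1 - Real.exp (-radial (t μ) q)) * G' (radial (t μ) q))) + 2 * H * q) q := by
      intro q _
      have e1 := ((((ht q).fun_neg.exp).const_sub 1).const_mul 2).const_mul k
      refine ((e1.fun_mul (hGt q)).fun_add ((hasDerivAt_pow 2 q).const_mul H)).congr_deriv ?_
      simp only [exp_neg_radial_t hμ]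
      have : 0 < μ ^ 2 + q ^ 2 := by positivity
      field_simp
      ring
    have hQ : ∀ q ∈ Set.Icc 0 R, HasDerivAt (fun q => q * w' q) (w' q + q * w'' q) q := by
      intro q hq
      refine ((hasDerivAt_id q).fun_mul (hw' q hq)).congr_deriv ?_
      simp
    have h2 := abs_le_of_abs_deriv_le hQ hP (by simp) (by simp [radial_t]) h
      (r := r) ⟨hr.1.le, hr.2⟩
    rw [abs_mul, abs_of_pos hr.1] at h2
    refine le_of_mul_le_mul_left (h2.trans_eq ?_) hr.1
    rw [exp_neg_radial_t hμ]
    have : 0 < μ ^ 2 + r ^ 2 := by positivity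
    field_simp
    ring
  refine ⟨h1, fun r hr => ?_⟩
  have hP : ∀ q ∈ Set.Icc 0 R, HasDerivAt
      (fun q => k * (radial (t μ) q * G (radial (t μ) q)) + H * q ^ 2 / 2)
      (k * (2 * q / (μ ^ 2 + q ^ 2) * G (radial (t μ) q) +
        radial (t μ) q * (G' (radial (t μ) q) * (2 * q / (μ ^ 2 + q ^ 2)))) + H * q) q := by
    intro q _
    refine ((((ht q).fun_mul (hGt q)).const_mul k).fun_add
      (((hasDerivAt_pow 2 q).const_mul H).div_const 2)).congr_deriv ?_
    simp
    ring
  refine abs_le_of_abs_deriv_le hw hP hw0 (by simp [radial_t]) ?_ hr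
  intro q hq
  refine (h1 q ⟨hq.1, hq.2.le⟩).trans ?_
  -- By monotonicity of G, differentiating kτG only adds a nonnegative term to the bound kGτ' on w'.
  have h3 : 0 ≤ radial (t μ) q * (G' (radial (t μ) q) * (2 * q / (μ ^ 2 + q ^ 2))) := by
    have := hq.1
    exact mul_nonneg (radial_t_nonneg q) (mul_nonneg (hG' _) (by positivity))
  nlinarith [mul_nonneg hk.le h3]

/-- Continuity argument: if the flux inequality holds wherever `w` lies below the weight, then it
holds everywhere, and so do the resulting bounds. -/
theorem bounds_of_flux_le_of_small (hμ : 0 < μ) (hk : 0 < k)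
    (hG : ∀ t, HasDerivAt G (G' t) t) (hG' : ∀ t, 0 ≤ G' t)
    (hw : ∀ r ∈ Set.Icc 0 R, HasDerivAt w (w' r) r)
    (hw' : ∀ r ∈ Set.Icc 0 R, HasDerivAt w' (w'' r) r) (hw0 : w 0 = 0)
    (hH : ∀ r ∈ Set.Icc 0 R, H * r ^ 2 / 2 < k)
    (h : ∀ r ∈ Set.Ioo 0 R, |w r| ≤ k * (1 + radial (t μ) r * G (radial (t μ) r)) →
      |w' r + r * w'' r| ≤
      4 * r / μ ^ 2 * Real.exp (-radial (t μ) r) *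
        (k * (Real.exp (-radial (t μ) r) * G (radial (t μ) r) +
          (1 - Real.exp (-radial (t μ) r)) * G' (radial (t μ) r))) + 2 * H * r) :
    ∀ r ∈ Set.Icc 0 R, |w r| ≤ k * (1 + radial (t μ) r * G (radial (t μ) r)) ∧
      |w r| ≤ k * (radial (t μ) r * G (radial (t μ) r)) + H * r ^ 2 / 2 ∧
      (0 < r → |w' r| ≤ k * G (radial (t μ) r) * (2 * r / (μ ^ 2 + r ^ 2)) + H * r) := by
  have step : ∀ r ∈ Set.Icc 0 R,
      (∀ q ∈ Set.Ioo 0 r, |w q| ≤ k * (1 + radial (t μ) q * G (radial (t μ) q))) →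
      |w r| ≤ k * (radial (t μ) r * G (radial (t μ) r)) + H * r ^ 2 / 2 ∧
      (0 < r → |w' r| ≤ k * G (radial (t μ) r) * (2 * r / (μ ^ 2 + r ^ 2)) + H * r) := by
    intro r hr hq
    have hsub : ∀ q ∈ Set.Icc 0 r, q ∈ Set.Icc 0 R := fun q hq => ⟨hq.1, hq.2.trans hr.2⟩
    have h1 := bounds_of_flux_le (R := r) (H := H) hμ hk hG hG' (fun q hq => hw q (hsub q hq))
      (fun q hq => hw' q (hsub q hq)) hw0
      (fun q hq' => h q ⟨hq'.1, hq'.2.trans_le hr.2⟩ (hq q hq'))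
    exact ⟨h1.2 r ⟨hr.1, le_rfl⟩, fun h0 => h1.1 r ⟨h0, le_rfl⟩⟩
  have main : ∀ r ∈ Set.Icc 0 R, |w r| ≤ k * (1 + radial (t μ) r * G (radial (t μ) r)) := by
    intro r hr
    by_contra! hcon
    set φ : ℝ → ℝ := fun q => |w q| - k * (1 + radial (t μ) q * G (radial (t μ) q)) with hφ
    have hsub : ∀ q ∈ Set.Icc 0 r, q ∈ Set.Icc 0 R := fun q hq => ⟨hq.1, hq.2.trans hr.2⟩
    have hcont : ContinuousOn φ (Set.Icc 0 r) := by
      intro q hq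
      have h1 := (hw q (hsub q hq)).continuousAt
      have h2 := (hasDerivAt_radial_t hμ q).continuousAt
      have h3 : ContinuousAt (fun r => G (radial (t μ) r)) q :=
        ContinuousAt.comp (g := G) (hG _).continuousAt h2
      exact (h1.abs.sub (continuousAt_const.mul
        (continuousAt_const.add (h2.mul h3)))).continuousWithinAt
    have hcl : IsClosed (Set.Icc 0 r ∩ φ ⁻¹' Set.Ici 0) :=
      hcont.preimage_isClosed_of_isClosed isClosed_Icc isClosed_Ici
    have hcpt : IsCompact (Set.Icc 0 r ∩ φ ⁻¹' Set.Ici 0) :=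
      isCompact_Icc.of_isClosed_subset hcl Set.inter_subset_left
    -- At the first radius m where |w| reaches k(1+τG), the integrated bound still holds and is
    -- strictly smaller since Hm²/2 < k.
    obtain ⟨m, hm⟩ := hcpt.exists_isLeast
      ⟨r, ⟨hr.1, le_rfl⟩, by simp only [hφ, Set.mem_preimage, Set.mem_Ici]; linarith⟩
    have hmR := hsub m hm.1.1
    have h4 := (step m hmR (fun q hq => by
      by_contra! hc
      have : m ≤ q := hm.2 ⟨⟨hq.1.le, hq.2.le.trans hm.1.1.2⟩, by
        simp only [hφ, Set.mem_preimage, Set.mem_Ici]; linarith⟩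
      linarith [hq.2])).1
    have h5 : 0 ≤ φ m := hm.1.2
    have h6 := hH m hmR
    simp only [hφ] at h5
    linarith
  intro r hr
  have h1 := step r hr (fun q hq => main q ⟨hq.1.le, hq.2.le.trans hr.2⟩)
  exact ⟨main r hr, h1.1, h1.2⟩

end Bootstrap

/-! ### The equation of the remainder and the a priori estimate. -/

/-- The normalisation of λ fixes the value of the nonlinearity at u = γ. The parameter τ is free,
because e^{-2τ} and e^{2τ} cancel; it is later taken to be t(r). -/
theorem nonlin_lam_eq {p μ γ u : ℝ} (hp : 0 < p) (hμ : 0 < μ) (hγ : 0 < γ) (hu : 0 < u)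
    (τ : ℝ) :
    nonlin p (lam p μ γ) u = 8 * Real.exp (-2 * τ) / (μ ^ 2 * γ ^ (p - 1) * p) *
      ((u / γ) ^ (p - 1) * Real.exp (γ ^ p * ((u / γ) ^ p - 1) + 2 * τ)) := by
  have h1 : γ ^ (2 * (p - 1)) = γ ^ (p - 1) * γ ^ (p - 1) := by
    rw [two_mul, Real.rpow_add hγ]
  have h2 : γ ^ p * ((u / γ) ^ p - 1) + 2 * τ = u ^ p + -(γ ^ p) + -(-2 * τ) := by
    have : 0 < γ ^ p := by positivity
    rw [Real.div_rpow hu.le hγ.le]; field_simp; ring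
  have h3 : 0 < γ ^ (p - 1) := by positivity
  rw [nonlin, lam, h1, h2, Real.exp_add, Real.exp_add, Real.div_rpow hu.le hγ.le, Real.exp_neg,
    Real.exp_neg]
  have := Real.exp_pos (-2 * τ)
  field_simp

theorem radial_w (p μ γ : ℝ) (B : Plane → ℝ) (r : ℝ) :
    radial (w p μ γ B) r =
      γ ^ p * (radial B r / γ - 1 + 2 * radial (t μ) r / (p * γ ^ p)) := rfl

theorem radial_div_eq {p μ γ : ℝ} (hp : 0 < p) (hγ : 0 < γ) (B : Plane → ℝ) (r : ℝ) :
    radial B r / γ =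
      1 - 2 * radial (t μ) r / (p * γ ^ p) + radial (w p μ γ B) r / γ ^ p := by
  have : 0 < γ ^ p := by positivity
  rw [radial_w]; field_simp; ring

/-- The rescaled nonlinearity `(B/γ)^{p-1} e^{B^p - γ^p + 2t}` along the radius. -/
noncomputable def rescaled (p μ γ : ℝ) (B : Plane → ℝ) (r : ℝ) : ℝ :=
  (radial B r / γ) ^ (p - 1) *
    Real.exp (γ ^ p * ((radial B r / γ) ^ p - 1) + 2 * radial (t μ) r)

section Remainder

variable {h₀ p μ γ s : ℝ} {B : Plane → ℝ}

theorem IsBubble.hasDerivAt_radial_w (hB : IsBubble h₀ p (lam p μ γ) γ s B) (hp : 0 < p)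
    (hμ : 0 < μ) (hγ : 0 < γ) {r : ℝ} (hr : |r| < s) :
    HasDerivAt (radial (w p μ γ B))
      (γ ^ p / γ * deriv (radial B) r + 2 / p * (2 * r / (μ ^ 2 + r ^ 2))) r := by
  have h : radial (w p μ γ B) = fun r =>
      γ ^ p * (radial B r / γ - 1 + 2 * radial (t μ) r / (p * γ ^ p)) := rfl
  rw [h]
  have h1 := ((hB.radial_contDiffAt hr).differentiableAt (by simp)).hasDerivAt
  refine ((((h1.div_const γ).sub_const 1).fun_add
    (((hasDerivAt_radial_t hμ r).const_mul 2).div_const (p * γ ^ p))).const_mul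
    (γ ^ p)).congr_deriv ?_
  have : 0 < γ ^ p := by positivity
  have : 0 < μ ^ 2 + r ^ 2 := by positivity
  field_simp

/-- The flux of the remainder. -/
theorem IsBubble.flux_eq (hB : IsBubble h₀ p (lam p μ γ) γ s B) (hp : 0 < p)
    (hμ : 0 < μ) (hγ : 0 < γ) {r : ℝ} (hr0 : 0 < r) (hr : r < s) :
    (γ ^ p / γ * deriv (radial B) r + 2 / p * (2 * r / (μ ^ 2 + r ^ 2))) +
      r * (γ ^ p / γ * deriv (deriv (radial B)) r +
        2 / p * (2 * (μ ^ 2 - r ^ 2) / (μ ^ 2 + r ^ 2) ^ 2)) =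
    h₀ * (γ ^ p * (radial B r / γ)) * r -
      4 * r / μ ^ 2 * Real.exp (-radial (t μ) r) *
        (2 / p * (Real.exp (-radial (t μ) r) * (rescaled p μ γ B r - 1))) := by
  have hpos := hB.radial_pos (r := r) (by rwa [abs_of_pos hr0])
  have heq := hB.radial_equation hr0 hr
  rw [nonlin_lam_eq hp hμ hγ hpos (radial (t μ) r), ← rescaled] at heq
  have h1 : Real.exp (-2 * radial (t μ) r) = (μ ^ 2 / (μ ^ 2 + r ^ 2)) ^ 2 := by
    rw [← exp_neg_radial_t hμ, ← Real.exp_nat_mul]; congr 1; push_cast; ring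
  rw [h1] at heq
  rw [exp_neg_radial_t hμ]
  have h2 : γ ^ p = γ ^ (p - 1) * γ := by rw [Real.rpow_sub_one hγ.ne']; field_simp
  rw [h2]
  have h3 : 0 < γ ^ (p - 1) := by positivity
  have h4 : 0 < μ ^ 2 + r ^ 2 := by positivity
  -- After this substitution, (rτ')' = (4r/μ²)e^{-2τ} is what turns the rescaled nonlinearity F into
  -- F - 1.
  have h5 : deriv (deriv (radial B)) r = h₀ * radial B r -
      8 * (μ ^ 2 / (μ ^ 2 + r ^ 2)) ^ 2 / (μ ^ 2 * γ ^ (p - 1) * p) * rescaled p μ γ B r -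
      deriv (radial B) r / r := by linarith
  rw [h5]
  generalize deriv (radial B) r = d
  generalize rescaled p μ γ B r = F
  field_simp
  ring

end Remainder

/-- Only τ² exceeds the growth of 1 + τg, and e^{-aτ}τ ≤ 1/a lowers it by one degree. -/
theorem exp_mul_poly_le {a τ g : ℝ} (ha : 0 < a) (hτ : 0 ≤ τ) (hg : 1 ≤ g) :
    Real.exp (-(a * τ)) * (2 * τ + 4 * τ ^ 2 + 6 * (1 + τ * g)) ≤ (8 + 4 / a) * (1 + τ * g) := by
  have h0 := Real.exp_pos (-(a * τ))
  have h1 : Real.exp (-(a * τ)) ≤ 1 := Real.exp_le_one_iff.2 (by nlinarith)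
  have h2 : Real.exp (-(a * τ)) * τ ≤ 1 / a := by
    have h3 := Real.add_one_le_exp (a * τ)
    have h4 : Real.exp (-(a * τ)) * Real.exp (a * τ) = 1 := by rw [← Real.exp_add]; simp
    rw [le_div_iff₀ ha]
    nlinarith
  have h5 : τ ≤ τ * g := le_mul_of_one_le_right hτ hg
  have h6 : Real.exp (-(a * τ)) * τ * τ ≤ 1 / a * τ := mul_le_mul_of_nonneg_right h2 hτ
  have h7 : 1 / a * τ ≤ 1 / a * (τ * g) := by gcongr
  have h8 : 0 ≤ 1 / a := by positivity
  have h9 : Real.exp (-(a * τ)) * (2 * τ + 6 * (1 + τ * g)) ≤ 1 * (2 * τ + 6 * (1 + τ * g)) :=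
    mul_le_mul_of_nonneg_right h1 (by positivity)
  have h10 : 4 / a = 4 * (1 / a) := by ring
  rw [h10]
  nlinarith

/-- The flux inequality, as long as the remainder lies below the weight. -/
theorem IsBubble.abs_flux_le {h₀ p μ γ s η ε a k q g g' : ℝ} {B : Plane → ℝ}
    (hB : IsBubble h₀ p (lam p μ γ) γ s B) (hp : p ∈ Set.Icc (1 : ℝ) 2)
    (hμ : 0 < μ) (hγ : 0 < γ) (hh₀ : 0 ≤ h₀) (hN1 : 1 ≤ γ ^ p) (hη : η ∈ Set.Ioo (0 : ℝ) 1)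
    (hε : ε = (1 - η) / 12) (ha : a = (1 - η) / 4) (hq0 : 0 < q) (hqs : q < s)
    (hτN : radial (t μ) q ≤ η * (p * γ ^ p / 2))
    (hsmall' : |radial (w p μ γ B) q| ≤ ε * (1 + radial (t μ) q))
    (hk0 : 0 ≤ k) (hkN : 1 / γ ^ p ≤ k) (hg1 : 1 ≤ g)
    (hsmall : |radial (w p μ γ B) q| ≤ k * (1 + radial (t μ) q * g))
    (hGw : 2 * Real.exp 1 * (8 + 4 / a) * Real.exp (-(a * radial (t μ) q)) *
      (1 + radial (t μ) q * g) ≤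
      Real.exp (-radial (t μ) q) * g + (1 - Real.exp (-radial (t μ) q)) * g') :
    |(γ ^ p / γ * deriv (radial B) q + 2 / p * (2 * q / (μ ^ 2 + q ^ 2))) +
      q * (γ ^ p / γ * deriv (deriv (radial B)) q +
        2 / p * (2 * (μ ^ 2 - q ^ 2) / (μ ^ 2 + q ^ 2) ^ 2))| ≤
      4 * q / μ ^ 2 * Real.exp (-radial (t μ) q) *
        (k * (Real.exp (-radial (t μ) q) * g + (1 - Real.exp (-radial (t μ) q)) * g')) +
      2 * (h₀ * γ ^ p) * q := by
  have hp0 : 0 < p := by linarith [hp.1]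
  have hN0 : 0 < γ ^ p := by linarith
  have hε0 : 0 < ε := by rw [hε]; linarith [hη.2]
  have ha0 : 0 < a := by rw [ha]; linarith [hη.2]
  have hy := radial_div_eq (μ := μ) hp0 hγ B q
  have hpos : 0 < radial B q / γ := div_pos (hB.radial_pos (by rwa [abs_of_pos hq0])) hγ
  have hτ0 : 0 ≤ radial (t μ) q := radial_t_nonneg q
  have hF := abs_rescaled_nonlin_sub_one_le (η' := η + 6 * ε) hp hN1 hτ0 hη hτN hε0
    (by rw [hε]; linarith [hη.1]) le_rfl hsmall' hy hpos
  rw [hB.flux_eq hp0 hμ hγ hq0 hqs]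
  change |rescaled p μ γ B q - 1| ≤ _ at hF
  generalize rescaled p μ γ B q = F at hF ⊢
  generalize radial (t μ) q = τ at *
  generalize radial (w p μ γ B) q = ω at *
  generalize radial B q / γ = y at *
  clear hB
  generalize γ ^ p = N at *
  -- The sharp bound B ≤ γ is not yet available; this crude one, from the smallness of w, suffices
  -- for the h₀-term.
  have hy2 : y ≤ 2 := by
    rw [hy]
    have h1 : 0 ≤ 2 * τ / (p * N) := by positivity
    have h2 : ω / N ≤ 1 := by
      rw [div_le_one hN0]
      have h3 := le_abs_self ω
      have h4 : τ ≤ N := by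
        have h5 : η * (p * N / 2) ≤ 1 * (p * N / 2) :=
          mul_le_mul_of_nonneg_right hη.2.le (by positivity)
        have h6 : p * N ≤ 2 * N := mul_le_mul_of_nonneg_right hp.2 hN0.le
        linarith
      have h5 : ε ≤ 1 / 12 := by rw [hε]; linarith [hη.1]
      nlinarith
    linarith
  have hFb : 2 / p * (Real.exp (-τ) * |F - 1|) ≤
      k * (Real.exp (-τ) * g + (1 - Real.exp (-τ)) * g') := by
    have h1 : (2 * τ + 4 * τ ^ 2) / N + 6 * |ω| ≤
        k * (2 * τ + 4 * τ ^ 2 + 6 * (1 + τ * g)) := by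
      have h2 : (2 * τ + 4 * τ ^ 2) / N ≤ k * (2 * τ + 4 * τ ^ 2) := by
        rw [div_eq_mul_one_div, mul_comm]; gcongr
      linarith
    -- The choices of ε and a give 1 - (η+6ε) = 2a: one factor e^{-aτ} absorbs the polynomial, the
    -- other is the decay required by the weight.
    have h3 : Real.exp (-τ) * Real.exp ((η + 6 * ε) * τ + 1) =
        Real.exp 1 * Real.exp (-(a * τ)) * Real.exp (-(a * τ)) := by
      rw [← Real.exp_add, ← Real.exp_add, ← Real.exp_add]; congr 1; rw [hε, ha]; ring
    have h4 := exp_mul_poly_le ha0 hτ0 hg1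
    have hp2 : 2 / p ≤ 2 := by
      rw [div_le_iff₀ hp0]; linarith [hp.1]
    calc 2 / p * (Real.exp (-τ) * |F - 1|)
        ≤ 2 * (Real.exp (-τ) * (Real.exp ((η + 6 * ε) * τ + 1) *
            (k * (2 * τ + 4 * τ ^ 2 + 6 * (1 + τ * g))))) := by
          gcongr
          exact hF.trans (by gcongr)
      _ = k * (2 * Real.exp 1 * Real.exp (-(a * τ)) * (Real.exp (-(a * τ)) *
            (2 * τ + 4 * τ ^ 2 + 6 * (1 + τ * g)))) := by
          rw [← mul_assoc (Real.exp (-τ)), h3]; ring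
      _ ≤ k * (2 * Real.exp 1 * Real.exp (-(a * τ)) * ((8 + 4 / a) * (1 + τ * g))) := by
          gcongr
      _ = k * (2 * Real.exp 1 * (8 + 4 / a) * Real.exp (-(a * τ)) * (1 + τ * g)) := by ring
      _ ≤ _ := by
          gcongr
  have e1 : |h₀ * (N * y) * q| ≤ 2 * (h₀ * N) * q := by
    rw [abs_of_nonneg (by positivity)]
    have : h₀ * (N * y) * q ≤ h₀ * (N * 2) * q := by gcongr
    linarith
  have e2 : |4 * q / μ ^ 2 * Real.exp (-τ) * (2 / p * (Real.exp (-τ) * (F - 1)))| ≤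
      4 * q / μ ^ 2 * Real.exp (-τ) *
        (k * (Real.exp (-τ) * g + (1 - Real.exp (-τ)) * g')) := by
    have e3 : |4 * q / μ ^ 2 * Real.exp (-τ) * (2 / p * (Real.exp (-τ) * (F - 1)))| =
        4 * q / μ ^ 2 * Real.exp (-τ) * (2 / p * (Real.exp (-τ) * |F - 1|)) := by
      rw [abs_mul, abs_of_nonneg (by positivity : 0 ≤ 4 * q / μ ^ 2 * Real.exp (-τ)), abs_mul,
        abs_of_nonneg (by positivity : 0 ≤ 2 / p), abs_mul, abs_of_pos (Real.exp_pos _)]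
    rw [e3]
    gcongr
  refine (abs_sub _ _).trans ?_
  linarith

set_option maxHeartbeats 1000000 in
/-- Quantitative form of the a priori estimates. -/
theorem apriori (h₀ η D : ℝ) (hh₀ : 0 < h₀) (hη : η ∈ Set.Ioo (0 : ℝ) 1) (hD : 0 < D) :
    ∃ K N₀ : ℝ, 0 < K ∧ 1 ≤ N₀ ∧ ∀ p μ γ s r : ℝ, ∀ B : Plane → ℝ,
      p ∈ Set.Icc (1 : ℝ) 2 → 0 < μ → 0 < γ → N₀ ≤ γ ^ p →
      (γ ^ p) ^ 2 * (μ ^ 2 + r ^ 2) ≤ D →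
      radial (t μ) r ≤ η * (p * γ ^ p / 2) →
      IsBubble h₀ p (lam p μ γ) γ s B → 0 ≤ r → r < s →
      |radial (w p μ γ B) r| ≤ K * (1 / γ ^ p * radial (t μ) r) ∧
      |deriv (radial (w p μ γ B)) r| ≤ K * (1 / γ ^ p * (2 * r / (μ ^ 2 + r ^ 2))) := by
  obtain ⟨hη0, hη1⟩ := hη
  set ε := (1 - η) / 12 with hε
  set a := (1 - η) / 4 with ha
  set C := 2 * Real.exp 1 * (8 + 4 / a) with hC
  have ha0 : 0 < a := by rw [ha]; linarith
  have hε0 : 0 < ε := by rw [hε]; linarith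
  have he1 : 1 ≤ Real.exp 1 := Real.one_le_exp zero_le_one
  have hC1 : 1 ≤ C := by
    have : 0 < 4 / a := by positivity
    nlinarith
  obtain ⟨G, G', A, hG, hG', hG1, hGA, hGw⟩ := exists_weight ha0 (by rw [ha]; linarith) hC1
  have hA1 : 1 ≤ A := (hG1 0 le_rfl).trans (hGA 0)
  -- With k = K₀/N, the 1 covers the source term of size 1/N, and h₀D keeps h₀Nr²/2 strictly below
  -- k.
  set K₀ := 1 + h₀ * D with hK₀
  have hK₀1 : 1 ≤ K₀ := by
    have : 0 < h₀ * D := by positivity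
    linarith
  -- The threshold on N makes k(1+A) ≤ ε, so lying below the weight implies the smallness |w| ≤
  -- ε(1+τ) needed for the comparison of nonlinearities.
  refine ⟨K₀ * A + h₀ * D, max 1 (K₀ * (1 + A) / ε), by positivity, le_max_left _ _, ?_⟩
  intro p μ γ s r B hp hμ hγ hN hsm ht hB hr0 hrs
  have hp0 : 0 < p := by linarith [hp.1]
  set N := γ ^ p with hNdef
  have hN1 : 1 ≤ N := (le_max_left _ _).trans hN
  have hN0 : 0 < N := by linarith
  have hNε : K₀ * (1 + A) ≤ ε * N := by
    have := (le_max_right _ _).trans hN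
    rw [div_le_iff₀ hε0] at this
    linarith
  set k := K₀ / N with hk
  have hk0 : 0 < k := by positivity
  have hkN : 1 / N ≤ k := by rw [hk]; gcongr
  have hsq : ∀ q, 0 ≤ q → q ≤ r → N * (μ ^ 2 + q ^ 2) ≤ D / N := by
    intro q hq0 hq
    have h1 : N ^ 2 * (μ ^ 2 + q ^ 2) ≤ N ^ 2 * (μ ^ 2 + r ^ 2) := by gcongr
    rw [le_div_iff₀ hN0]
    linarith
  have habs : ∀ q ∈ Set.Icc 0 r, |q| < s := fun q hq => by
    rw [abs_of_nonneg hq.1]; linarith [hq.2]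
  have hω := fun q hq => hB.hasDerivAt_radial_w hp0 hμ hγ (habs q hq)
  have hω' : ∀ q ∈ Set.Icc 0 r, HasDerivAt
      (fun q => N / γ * deriv (radial B) q + 2 / p * (2 * q / (μ ^ 2 + q ^ 2)))
      (N / γ * deriv (deriv (radial B)) q +
        2 / p * (2 * (μ ^ 2 - q ^ 2) / (μ ^ 2 + q ^ 2) ^ 2)) q := by
    intro q hq
    have h1 := hasDerivAt_deriv_of_contDiffAt (hB.radial_contDiffAt (habs q hq))
    have h2 : 0 < μ ^ 2 + q ^ 2 := by positivity
    have h3 := ((hasDerivAt_id q).const_mul 2).fun_div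
      ((hasDerivAt_pow 2 q).const_add (μ ^ 2)) h2.ne'
    refine ((h1.const_mul (N / γ)).fun_add (h3.const_mul (2 / p))).congr_deriv ?_
    simp
    field_simp
    ring_nf
    simp
  have hω0 : radial (w p μ γ B) 0 = 0 := by
    simp [radial_w, hB.radial_zero, radial_t, div_self hγ.ne']
  have main := bounds_of_flux_le_of_small (H := h₀ * N) (R := r) hμ hk0 hG hG' hω hω' hω0 (by
      intro q hq
      have h1 := hsq q hq.1 hq.2
      have h2 : N * q ^ 2 ≤ D / N := by nlinarith [sq_nonneg μ]
      have h3 : h₀ * (N * q ^ 2) ≤ h₀ * (D / N) := by gcongr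
      have h4 : k = 1 / N + h₀ * (D / N) := by rw [hk, hK₀]; ring
      have h5 : 0 < 1 / N := by positivity
      have h6 : 0 ≤ h₀ * (D / N) := by positivity
      nlinarith) (by
      intro q hq hsmall
      have hqs : q < s := hq.2.trans hrs
      set τ := radial (t μ) q with hτ
      have hτ0 : 0 ≤ τ := radial_t_nonneg q
      have hτN : τ ≤ η * (p * N / 2) := (radial_t_mono hμ hq.1.le hq.2.le).trans ht
      set g := G τ with hg
      have hg1 : 1 ≤ g := hG1 τ hτ0
      have hgA : g ≤ A := hGA τ
      have hsmall' : |radial (w p μ γ B) q| ≤ ε * (1 + τ) := by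
        refine hsmall.trans ?_
        have h1 : 1 + τ * g ≤ (1 + A) * (1 + τ) := by nlinarith [mul_le_mul_of_nonneg_left hgA hτ0]
        have h2 : k * (1 + A) ≤ ε := by
          rw [hk, div_mul_eq_mul_div, div_le_iff₀ hN0]; exact hNε
        calc k * (1 + τ * g) ≤ k * ((1 + A) * (1 + τ)) := by gcongr
          _ = k * (1 + A) * (1 + τ) := by ring
          _ ≤ _ := by gcongr
      exact hB.abs_flux_le hp hμ hγ hh₀.le hN1 ⟨hη0, hη1⟩ hε ha hq.1 hqs hτN hsmall' hk0.le hkN hg1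
        hsmall (hGw τ hτ0))
  obtain ⟨-, m1, m2⟩ := main r ⟨hr0, le_rfl⟩
  have hτ0 : 0 ≤ radial (t μ) r := radial_t_nonneg r
  have hs := hsq r hr0 le_rfl
  have hpos : 0 < μ ^ 2 + r ^ 2 := by positivity
  have hGAr := hGA (radial (t μ) r)
  constructor
  · refine m1.trans ?_
    -- The h₀-contribution must be bounded by a multiple of τ/N, vanishing at the centre, and not
    -- merely by a constant over N.
    have h1 : N * r ^ 2 ≤ D / N * radial (t μ) r := by
      calc N * r ^ 2 ≤ N * ((μ ^ 2 + r ^ 2) * radial (t μ) r) := by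
            gcongr; exact sq_le_mul_radial_t hμ r
        _ = N * (μ ^ 2 + r ^ 2) * radial (t μ) r := by ring
        _ ≤ _ := by gcongr
    have h2 : k * (radial (t μ) r * G (radial (t μ) r)) ≤ k * (radial (t μ) r * A) := by gcongr
    have h3 : h₀ * (N * r ^ 2) ≤ h₀ * (D / N * radial (t μ) r) := by gcongr
    have h4 : 0 ≤ h₀ * (D / N * radial (t μ) r) := by positivity
    calc _ ≤ k * (radial (t μ) r * A) + h₀ * (D / N * radial (t μ) r) := by linarith
      _ = _ := by rw [hk]; ring
  · rcases hr0.eq_or_lt with h0 | h0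
    · subst h0
      rw [(hω 0 ⟨le_rfl, le_rfl⟩).deriv, hB.deriv_radial_zero]
      simp
    · rw [(hω r ⟨hr0, le_rfl⟩).deriv]
      refine (m2 h0).trans ?_
      have h1 : N * r ≤ D / N * (2 * r / (μ ^ 2 + r ^ 2)) := by
        calc N * r ≤ N * r * 2 := by nlinarith [mul_pos hN0 h0]
          _ = N * (μ ^ 2 + r ^ 2) * (2 * r / (μ ^ 2 + r ^ 2)) := by field_simp
          _ ≤ _ := by gcongr
      have h2 : k * G (radial (t μ) r) * (2 * r / (μ ^ 2 + r ^ 2)) ≤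
          k * A * (2 * r / (μ ^ 2 + r ^ 2)) := by gcongr
      have h3 : h₀ * (N * r) ≤ h₀ * (D / N * (2 * r / (μ ^ 2 + r ^ 2))) := by gcongr
      calc _ ≤ k * A * (2 * r / (μ ^ 2 + r ^ 2)) +
            h₀ * (D / N * (2 * r / (μ ^ 2 + r ^ 2))) := by linarith
        _ = _ := by rw [hk]; ring

/-! ### Global solutions of the truncated radial equation. -/

/-- The average of `F` over the segment from `0` to `x`. -/
noncomputable def avg (F : ℝ → ℝ) (x : ℝ) : ℝ := ∫ θ in (0 : ℝ)..1, F (x * θ)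

theorem continuous_avg {F : ℝ → ℝ} (hF : Continuous F) : Continuous (avg F) := by
  unfold avg
  exact intervalIntegral.continuous_parametric_intervalIntegral_of_continuous' (by fun_prop) 0 1

/-- The average is thus the quotient of the primitive by x, extended regularly through x = 0. This
removes the singularity of the radial equation at the origin. -/
theorem mul_avg (F : ℝ → ℝ) (x : ℝ) : x * avg F x = ∫ u in (0 : ℝ)..x, F u := by
  rw [avg, intervalIntegral.mul_integral_comp_mul_left]
  simp

theorem hasDerivAt_mul_avg {F : ℝ → ℝ} (hF : Continuous F) (x : ℝ) :
    HasDerivAt (fun x => x * avg F x) (F x) x := by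
  simp only [mul_avg]
  exact intervalIntegral.integral_hasDerivAt_right (hF.intervalIntegrable 0 x)
    (hF.stronglyMeasurableAtFilter _ _) hF.continuousAt

theorem contDiff_avg {F : ℝ → ℝ} (hF : ContDiff ℝ 1 F) : ContDiff ℝ 1 (avg F) := by
  have hd : ∀ x, HasDerivAt F (deriv F x) x := fun x =>
    (hF.differentiable (by simp) x).hasDerivAt
  have hc : Continuous (deriv F) := hF.continuous_deriv (by simp)
  have hFc := hF.continuous
  have key : ∀ x, HasDerivAt (avg F) (∫ θ in (0 : ℝ)..1, deriv F (x * θ) * θ) x := by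
    intro x
    obtain ⟨C, hC⟩ := (isCompact_Icc (a := -(|x| + 1)) (b := |x| + 1)).exists_bound_of_continuousOn
      hc.continuousOn
    refine (intervalIntegral.hasDerivAt_integral_of_dominated_loc_of_deriv_le
      (F := fun x θ => F (x * θ)) (F' := fun x θ => deriv F (x * θ) * θ) (bound := fun _ => C)
      (Metric.ball_mem_nhds x one_pos) ?_ ?_ ?_ ?_ ?_ ?_).2
    · exact Eventually.of_forall fun y =>
        (by fun_prop : Continuous fun θ => F (y * θ)).aestronglyMeasurable
    · exact (by fun_prop : Continuous fun θ => F (x * θ)).intervalIntegrable _ _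
    · exact (by fun_prop : Continuous fun θ => deriv F (x * θ) * θ).aestronglyMeasurable
    · refine Eventually.of_forall fun θ hθ y hy => ?_
      rw [Set.uIoc_of_le zero_le_one] at hθ
      have h1 : |y| ≤ |x| + 1 := by
        have h2 : |y - x| < 1 := by simpa [Real.dist_eq] using hy
        have h3 := abs_sub_abs_le_abs_sub y x
        linarith
      have h2 : |y * θ| ≤ |x| + 1 := by
        rw [abs_mul, abs_of_pos hθ.1]
        exact (mul_le_of_le_one_right (abs_nonneg y) hθ.2).trans h1
      have h3 := hC (y * θ) (abs_le.1 h2)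
      rw [norm_mul, Real.norm_eq_abs θ, abs_of_pos hθ.1]
      exact (mul_le_of_le_one_right (norm_nonneg _) hθ.2).trans h3
    · simp
    · refine Eventually.of_forall fun θ _ y _ => ?_
      have h1 : HasDerivAt (fun y : ℝ => y * θ) θ y := by
        simpa using (hasDerivAt_id y).mul_const θ
      exact (hd (y * θ)).comp y h1
  rw [contDiff_one_iff_deriv]
  refine ⟨fun x => (key x).differentiableAt, ?_⟩
  have : deriv (avg F) = fun x => ∫ θ in (0 : ℝ)..1, deriv F (x * θ) * θ :=
    funext fun x => (key x).deriv
  rw [this]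
  exact intervalIntegral.continuous_parametric_intervalIntegral_of_continuous' (by fun_prop) 0 1

theorem abs_avg_sub_avg_le {F G : ℝ → ℝ} (hF : Continuous F) (hG : Continuous G) {κ d x : ℝ}
    (h : ∀ u, |F u - G u| ≤ d * Real.exp (κ * |u|)) :
    |avg F x - avg G x| ≤ ∫ θ in (0 : ℝ)..1, d * Real.exp (κ * |x| * θ) := by
  have hF' : Continuous fun θ => F (x * θ) := by fun_prop
  have hG' : Continuous fun θ => G (x * θ) := by fun_prop
  rw [avg, avg, ← intervalIntegral.integral_sub (hF'.intervalIntegrable _ _)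
    (hG'.intervalIntegrable _ _), ← Real.norm_eq_abs]
  refine intervalIntegral.norm_integral_le_of_norm_le zero_le_one ?_
    ((by fun_prop : Continuous fun θ => d * Real.exp (κ * |x| * θ)).intervalIntegrable _ _)
  refine Eventually.of_forall fun θ hθ => ?_
  refine (h (x * θ)).trans_eq ?_
  rw [abs_mul, abs_of_pos hθ.1, mul_assoc]

theorem mul_integral_exp (c : ℝ) : c * ∫ θ in (0 : ℝ)..1, Real.exp (c * θ) = Real.exp c - 1 := by
  rw [intervalIntegral.mul_integral_comp_mul_left]
  simp

theorem abs_avg_sub_avg_le_exp {F G : ℝ → ℝ} (hF : Continuous F) (hG : Continuous G) {κ d : ℝ}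
    (hκ : 0 ≤ κ) (h : ∀ u, |F u - G u| ≤ d * Real.exp (κ * |u|)) (x : ℝ) :
    |avg F x - avg G x| ≤ d * Real.exp (κ * |x|) := by
  have hd : 0 ≤ d := by
    have := (abs_nonneg _).trans (h 0)
    exact nonneg_of_mul_nonneg_left this (Real.exp_pos _)
  refine (abs_avg_sub_avg_le hF hG h).trans ?_
  have h1 : ∫ θ in (0 : ℝ)..1, d * Real.exp (κ * |x| * θ) ≤
      ∫ θ in (0 : ℝ)..1, d * Real.exp (κ * |x|) := by
    refine intervalIntegral.integral_mono_on zero_le_one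
      ((by fun_prop : Continuous fun θ => d * Real.exp (κ * |x| * θ)).intervalIntegrable _ _)
      (by simp) ?_
    intro θ hθ
    have : κ * |x| * θ ≤ κ * |x| := mul_le_of_le_one_right (by positivity) hθ.2
    gcongr
  simpa using h1

/-- Integrating e^{κ|u|} gains a factor 1/κ; this gain produces the contraction in the exponentially
weighted norm. -/
theorem abs_mul_avg_sub_avg_le_exp {F G : ℝ → ℝ} (hF : Continuous F) (hG : Continuous G)
    {κ d : ℝ} (hκ : 0 < κ) (h : ∀ u, |F u - G u| ≤ d * Real.exp (κ * |u|)) (x : ℝ) :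
    |x| * |avg F x - avg G x| ≤ d / κ * Real.exp (κ * |x|) := by
  have hd : 0 ≤ d := by
    have := (abs_nonneg _).trans (h 0)
    exact nonneg_of_mul_nonneg_left this (Real.exp_pos _)
  have h1 := mul_le_mul_of_nonneg_left (abs_avg_sub_avg_le hF hG (x := x) h) (abs_nonneg x)
  refine h1.trans ?_
  rw [intervalIntegral.integral_const_mul]
  have h2 := mul_integral_exp (κ * |x|)
  have h3 : |x| * (d * ∫ θ in (0 : ℝ)..1, Real.exp (κ * |x| * θ)) =
      d / κ * (Real.exp (κ * |x|) - 1) := by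
    rw [← h2]; field_simp
  rw [h3]
  gcongr
  linarith

open scoped BoundedContinuousFunction in
/-- Solution of the radial equation, in the variable `ρ = |x|²`, as a fixed point. -/
theorem exists_integral_solution {M : ℝ → ℝ} {L : NNReal} {b : ℝ} (hM : LipschitzWith L M)
    (hb : ∀ u, |M u| ≤ b) (γ : ℝ) :
    ∃ f : ℝ → ℝ, Continuous f ∧ ∀ x, f x = γ - x * avg (avg fun u => M (f u)) x / 4 := by
  set κ : ℝ := L + 1 with hκ
  have hL0 : (0 : ℝ) ≤ L := L.coe_nonneg
  have hκ0 : 0 < κ := by rw [hκ]; positivity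
  have hMc := hM.continuous
  -- The unknown is f = γ + e^{κ|u|}h with h bounded. Since κ = L + 1, the contraction constant
  -- L/(4κ) is at most 1/4 on the whole line, without a restriction to short intervals.
  let E : (ℝ →ᵇ ℝ) → ℝ → ℝ := fun h u => γ + Real.exp (κ * |u|) * h u
  have hE : ∀ h, Continuous (E h) := fun h => by
    have := h.continuous
    simp only [E]; fun_prop
  have hME : ∀ h, Continuous fun u => M (E h u) := fun h => hMc.comp (hE h)
  let S : (ℝ →ᵇ ℝ) → ℝ → ℝ := fun h x =>
    -(Real.exp (-(κ * |x|)) * (x * avg (avg fun u => M (E h u)) x / 4))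
  have hSc : ∀ h, Continuous (S h) := fun h => by
    have := continuous_avg (continuous_avg (hME h))
    simp only [S]; fun_prop
  have hexp : ∀ x, Real.exp (-(κ * |x|)) * Real.exp (κ * |x|) = 1 := fun x => by
    rw [← Real.exp_add]; simp
  have hdiff : ∀ (F₁ F₂ : ℝ → ℝ) (d : ℝ), Continuous F₁ → Continuous F₂ →
      (∀ u, |F₁ u - F₂ u| ≤ d * Real.exp (κ * |u|)) → ∀ x,
      |(-(Real.exp (-(κ * |x|)) * (x * avg (avg F₁) x / 4))) -
        (-(Real.exp (-(κ * |x|)) * (x * avg (avg F₂) x / 4)))| ≤ d / κ / 4 := by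
    intro F₁ F₂ d h1 h2 h x
    have h3 := abs_mul_avg_sub_avg_le_exp (continuous_avg h1) (continuous_avg h2) hκ0
      (abs_avg_sub_avg_le_exp h1 h2 hκ0.le h) x
    have h4 : (-(Real.exp (-(κ * |x|)) * (x * avg (avg F₁) x / 4))) -
        (-(Real.exp (-(κ * |x|)) * (x * avg (avg F₂) x / 4))) =
        -(Real.exp (-(κ * |x|)) * (x * (avg (avg F₁) x - avg (avg F₂) x)) / 4) := by ring
    rw [h4, abs_neg, abs_div, abs_mul, abs_mul, abs_of_pos (Real.exp_pos _),
      abs_of_pos (by norm_num : (0 : ℝ) < 4)]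
    refine div_le_div_of_nonneg_right ?_ (by norm_num)
    calc _ ≤ Real.exp (-(κ * |x|)) * (d / κ * Real.exp (κ * |x|)) := by gcongr
      _ = d / κ * (Real.exp (-(κ * |x|)) * Real.exp (κ * |x|)) := by ring
      _ = d / κ := by rw [hexp, mul_one]
  have hSb : ∀ h x, ‖S h x‖ ≤ b / κ / 4 := by
    intro h x
    have hb0 : 0 ≤ b := (abs_nonneg _).trans (hb 0)
    have h1 := hdiff (fun u => M (E h u)) (fun _ => 0) b (hME h) continuous_const (fun u => by
      simp only [sub_zero]
      refine (hb _).trans (le_mul_of_one_le_right hb0 (Real.one_le_exp (by positivity)))) x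
    have h2 : avg (avg fun _ => (0 : ℝ)) x = 0 := by simp [avg]
    rw [h2] at h1
    simpa [S, abs_mul, abs_div] using h1
  let Φ : (ℝ →ᵇ ℝ) → (ℝ →ᵇ ℝ) := fun h =>
    BoundedContinuousFunction.ofNormedAddCommGroup (S h) (hSc h) (b / κ / 4) (hSb h)
  have hΦ : ContractingWith (1 / 4) Φ := by
    refine ⟨by rw [← NNReal.coe_lt_coe]; norm_num, LipschitzWith.of_dist_le_mul fun h g => ?_⟩
    rw [BoundedContinuousFunction.dist_le (by positivity)]
    intro x
    have h1 := hdiff (fun u => M (E h u)) (fun u => M (E g u)) (L * dist h g) (hME h) (hME g)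
      (fun u => by
        have h2 := hM.dist_le_mul (E h u) (E g u)
        rw [Real.dist_eq, Real.dist_eq] at h2
        have h3 : E h u - E g u = Real.exp (κ * |u|) * (h u - g u) := by simp only [E]; ring
        rw [h3, abs_mul, abs_of_pos (Real.exp_pos _)] at h2
        have h4 : |h u - g u| ≤ dist h g := by
          rw [← Real.dist_eq]; exact BoundedContinuousFunction.dist_coe_le_dist u
        calc _ ≤ _ := h2
          _ ≤ L * (Real.exp (κ * |u|) * dist h g) := by gcongr
          _ = _ := by ring) x
    rw [Real.dist_eq]
    refine h1.trans ?_
    have h5 : (L : ℝ) / κ ≤ 1 := by rw [div_le_one hκ0, hκ]; linarith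
    have h6 : (0 : ℝ) ≤ dist h g := dist_nonneg
    calc (L : ℝ) * dist h g / κ / 4 = L / κ * (dist h g / 4) := by ring
      _ ≤ 1 * (dist h g / 4) := by gcongr
      _ = _ := by push_cast; ring
  obtain ⟨h, hh⟩ : ∃ h, Φ h = h := ⟨_, hΦ.fixedPoint_isFixedPt⟩
  refine ⟨E h, hE h, fun x => ?_⟩
  have h1 : h x = S h x := by
    conv_lhs => rw [← hh]
    rfl
  have h2 : E h x = γ + Real.exp (κ * |x|) * h x := rfl
  rw [h2, h1]
  simp only [S]
  linear_combination (-(x * avg (avg fun u => M (E h u)) x / 4)) * hexp x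

/-- Classical radial solutions of `-Δ f = M(f)` in the variable `ρ = |x|²`. -/
theorem exists_contDiff_solution {M : ℝ → ℝ} (hM : ContDiff ℝ 1 M) (hMs : HasCompactSupport M)
    (γ : ℝ) :
    ∃ f : ℝ → ℝ, ContDiff ℝ 2 f ∧ f 0 = γ ∧
      ∀ x, 4 * deriv f x + 4 * x * deriv (deriv f) x = -M (f x) := by
  obtain ⟨L, hL⟩ := hM.lipschitzWith_of_hasCompactSupport hMs (by simp)
  obtain ⟨b, hb⟩ := hMs.exists_bound_of_continuous hM.continuous
  obtain ⟨f, hfc, hf⟩ := exists_integral_solution hL hb γ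
  have hMf : Continuous fun u => M (f u) := hM.continuous.comp hfc
  have h1 : ∀ x, HasDerivAt f (-(avg (fun u => M (f u)) x / 4)) x := by
    intro x
    have h2 := ((hasDerivAt_mul_avg (continuous_avg hMf) x).div_const 4).const_sub γ
    exact h2.congr_of_eventuallyEq (Eventually.of_forall hf)
  have hd : deriv f = fun x => -(avg (fun u => M (f u)) x / 4) := funext fun x => (h1 x).deriv
  -- Bootstrap: f' is an average of M∘f, so f is C¹, then M∘f and its average are C¹, and f is C².
  have hf1 : ContDiff ℝ 1 f := by
    rw [contDiff_one_iff_deriv, hd]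
    exact ⟨fun x => (h1 x).differentiableAt, ((continuous_avg hMf).div_const 4).neg⟩
  have hd1 : ContDiff ℝ 1 (deriv f) := by
    rw [hd]
    exact ((contDiff_avg (hM.comp hf1)).div_const 4).neg
  refine ⟨f, ?_, by rw [hf]; simp, ?_⟩
  · rw [show (2 : WithTop ℕ∞) = 1 + 1 by norm_num, contDiff_succ_iff_deriv]
    exact ⟨fun x => (h1 x).differentiableAt, by simp, hd1⟩
  · intro x
    have h2 : HasDerivAt (fun x => x * deriv f x) (1 * deriv f x + x * deriv (deriv f) x) x :=
      (hasDerivAt_id x).fun_mul (hd1.differentiable (by simp) x).hasDerivAt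
    have h3 : HasDerivAt (fun x => x * deriv f x) (-(M (f x) / 4)) x := by
      have h4 := ((hasDerivAt_mul_avg hMf x).div_const 4).fun_neg
      refine h4.congr_of_eventuallyEq (Eventually.of_forall fun y => ?_)
      simp only [hd]; ring
    have h5 := h2.unique h3
    linarith

theorem contDiffAt_nonlin {p l u : ℝ} (hu : 0 < u) : ContDiffAt ℝ 1 (nonlin p l) u := by
  unfold nonlin
  have h1 : ∀ q : ℝ, ContDiffAt ℝ 1 (fun u : ℝ => u ^ q) u := fun q =>
    Real.contDiffAt_rpow_const_of_ne hu.ne'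
  exact (contDiffAt_const.mul (h1 _)).mul (h1 p).exp

/-- A global radial function solving the equation wherever its values lie in `[cγ, 2γ]`. -/
theorem exists_truncated_solution (h₀ p l : ℝ) {γ c : ℝ} (hγ : 0 < γ) (hc : 0 < c) (hc1 : c < 1) :
    ∃ f : ℝ → ℝ, ContDiff ℝ 2 f ∧ f 0 = γ ∧ ∀ x : Plane,
      f (‖x‖ ^ 2) ∈ Set.Icc (c * γ) (2 * γ) →
      -(Laplacian.laplacian (fun y : Plane => f (‖y‖ ^ 2)) x) + h₀ * f (‖x‖ ^ 2) =
        nonlin p l (f (‖x‖ ^ 2)) := by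
  have hcγ : 0 < c * γ := by positivity
  have hcγ' : c * γ < γ := by nlinarith
  -- The cutoff equals 1 on [cγ, 2γ] and vanishes below cγ/2, away from the possible singularity of
  -- the powers at 0.
  let β : ContDiffBump ((c * γ + 2 * γ) / 2) :=
    ⟨(2 * γ - c * γ) / 2, (2 * γ - c * γ) / 2 + c * γ / 2, by linarith, by linarith⟩
  let M : ℝ → ℝ := fun u => β u * (nonlin p l u - h₀ * u)
  have hM : ContDiff ℝ 1 M := by
    rw [contDiff_iff_contDiffAt]
    intro u
    rcases lt_or_ge 0 u with hu | hu
    · exact β.contDiffAt.mul ((contDiffAt_nonlin hu).sub (contDiffAt_const.mul contDiffAt_id))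
    · have h1 : M =ᶠ[𝓝 u] fun _ => 0 := by
        have h2 : ∀ᶠ v in 𝓝 u, v < c * γ / 2 := eventually_lt_nhds (by linarith)
        filter_upwards [h2] with v hv
        have h3 : β v = 0 := by
          refine β.zero_of_le_dist ?_
          rw [Real.dist_eq, abs_of_nonpos (by linarith)]
          show (2 * γ - c * γ) / 2 + c * γ / 2 ≤ _
          linarith
        simp [M, h3]
      exact contDiffAt_const.congr_of_eventuallyEq h1
  have hMs : HasCompactSupport M := β.hasCompactSupport.mul_right
  obtain ⟨f, hf, hf0, hfe⟩ := exists_contDiff_solution hM hMs γ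
  refine ⟨f, hf, hf0, fun x hx => ?_⟩
  rw [laplacian_comp_norm_sq hf, hfe]
  have h1 : β (f (‖x‖ ^ 2)) = 1 := by
    refine β.one_of_mem_closedBall ?_
    rw [Metric.mem_closedBall, Real.dist_eq, abs_le]
    show -((2 * γ - c * γ) / 2) ≤ _ ∧ _ ≤ (2 * γ - c * γ) / 2
    constructor <;> linarith [hx.1, hx.2]
  simp only [M, h1]
  ring

/-! ### Consequences of the remainder estimate, and continuation of the bubble. -/

/-- Once K ≤ γ^p, |w| ≤ τ ≤ 2τ/p, so the remainder cannot outweigh the decrease of the profile. -/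
theorem radial_le_of_remainder_le {p μ γ K r : ℝ} {B : Plane → ℝ} (hp : p ∈ Set.Icc (1 : ℝ) 2)
    (hγ : 0 < γ) (hK : K ≤ γ ^ p)
    (hw : |radial (w p μ γ B) r| ≤ K * (1 / γ ^ p * radial (t μ) r)) : radial B r ≤ γ := by
  have hp0 : 0 < p := by linarith [hp.1]
  have hN : 0 < γ ^ p := by positivity
  have hy := radial_div_eq (μ := μ) hp0 hγ B r
  have hτ : 0 ≤ radial (t μ) r := radial_t_nonneg r
  have h1 : K * (1 / γ ^ p * radial (t μ) r) ≤ radial (t μ) r := by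
    calc _ = K / γ ^ p * radial (t μ) r := by ring
      _ ≤ 1 * radial (t μ) r := by
        gcongr; rwa [div_le_one hN]
      _ = _ := one_mul _
  have h2 : radial (t μ) r ≤ 2 * radial (t μ) r / p := by
    rw [le_div_iff₀ hp0]; nlinarith [hp.2]
  have h3 := (le_abs_self _).trans (hw.trans (h1.trans h2))
  have h4 : radial (w p μ γ B) r / γ ^ p ≤ 2 * radial (t μ) r / (p * γ ^ p) := by
    rw [← div_div]; gcongr
  rw [← div_le_one hγ, hy]
  linarith

/-- The profile 1 - 2τ/(pγ^p) stays above 1 - η, and the remainder costs at most half of that. -/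
theorem le_radial_of_remainder_le {p μ γ K η r : ℝ} {B : Plane → ℝ}
    (hp : p ∈ Set.Icc (1 : ℝ) 2) (hγ : 0 < γ) (hη : η ∈ Set.Ioo (0 : ℝ) 1) (hK0 : 0 < K)
    (hK : K ≤ (1 - η) / 2 * γ ^ p) (ht : radial (t μ) r ≤ η * (p * γ ^ p / 2))
    (hw : |radial (w p μ γ B) r| ≤ K * (1 / γ ^ p * radial (t μ) r)) :
    (1 - η) / 2 * γ ≤ radial B r := by
  have hp0 : 0 < p := by linarith [hp.1]
  have hy := radial_div_eq (μ := μ) hp0 hγ B r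
  rw [← le_div_iff₀ hγ, hy]
  have hN : 0 < γ ^ p := by positivity
  generalize γ ^ p = N at *
  generalize radial (t μ) r = τ at *
  have h1 : 2 * τ / (p * N) ≤ η := by
    rw [div_le_iff₀ (by positivity)]; linarith
  have hτN : τ ≤ N := by
    have h5 : η * (p * N / 2) ≤ 1 * (p * N / 2) :=
      mul_le_mul_of_nonneg_right hη.2.le (by positivity)
    have h6 : p * N ≤ 2 * N := mul_le_mul_of_nonneg_right hp.2 hN.le
    linarith
  have h2 : K * (1 / N * τ) ≤ K := by
    refine mul_le_of_le_one_right hK0.le ?_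
    rw [one_div_mul_eq_div, div_le_one hN]; exact hτN
  have h3 : -((1 - η) / 2) ≤ radial (w p μ γ B) r / N := by
    rw [le_div_iff₀ hN]
    have := neg_abs_le (radial (w p μ γ B) r)
    linarith
  linarith

/-- The comparison is applied at the midpoint of η and η', which is η + 6ε for ε = (η'-η)/12. The
remaining exponent (η'-η)/2 absorbs τ and τ². -/
theorem abs_rescaled_sub_one_le {p μ γ K η η' r : ℝ} {B : Plane → ℝ}
    (hp : p ∈ Set.Icc (1 : ℝ) 2) (hγ : 0 < γ) (hη : η ∈ Set.Ioo (0 : ℝ) 1)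
    (hη' : η' ∈ Set.Ioo η 1) (hK0 : 0 < K) (hN : 1 ≤ γ ^ p) (hK : K ≤ (η' - η) / 12 * γ ^ p)
    (ht : radial (t μ) r ≤ η * (p * γ ^ p / 2)) (hB : 0 < radial B r)
    (hw : |radial (w p μ γ B) r| ≤ K * (1 / γ ^ p * radial (t μ) r)) :
    |rescaled p μ γ B r - 1| ≤
      Real.exp 1 * ((2 + 6 * K) / ((η' - η) / 2) + 8 / ((η' - η) / 2) ^ 2) *
        (Real.exp (η' * radial (t μ) r) / γ ^ p) := by
  have hp0 : 0 < p := by linarith [hp.1]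
  have hN0 : 0 < γ ^ p := by linarith
  have hτ : 0 ≤ radial (t μ) r := radial_t_nonneg r
  have hd : 0 < η' - η := by linarith [hη'.1]
  have hw1 : |radial (w p μ γ B) r| ≤ (η' - η) / 12 * (1 + radial (t μ) r) := by
    calc _ ≤ _ := hw
      _ = K / γ ^ p * radial (t μ) r := by ring
      _ ≤ (η' - η) / 12 * radial (t μ) r := by
        refine mul_le_mul_of_nonneg_right ?_ hτ
        rwa [div_le_iff₀ hN0]
      _ ≤ _ := by nlinarith
  have hF := abs_rescaled_nonlin_sub_one_le (η' := (η + η') / 2) hp hN hτ hη ht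
    (by positivity : 0 < (η' - η) / 12) (by linarith [hη'.2, hη.1]) (by linarith) hw1
    (radial_div_eq hp0 hγ B r) (div_pos hB hγ)
  change |rescaled p μ γ B r - 1| ≤ _ at hF
  refine hF.trans ?_
  generalize radial (t μ) r = τ at *
  generalize radial (w p μ γ B) r = ω at *
  generalize γ ^ p = N at *
  set a := (η' - η) / 2 with ha
  have ha0 : 0 < a := by positivity
  have h1 : τ ≤ 1 / a * Real.exp (a * τ) := by
    have := Real.add_one_le_exp (a * τ)
    rw [one_div_mul_eq_div, le_div_iff₀ ha0]; linarith
  have h2 : τ ^ 2 ≤ 2 / a ^ 2 * Real.exp (a * τ) := by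
    have := Real.quadratic_le_exp_of_nonneg (x := a * τ) (by positivity)
    rw [div_mul_eq_mul_div, le_div_iff₀ (by positivity)]
    nlinarith [mul_nonneg ha0.le hτ]
  have h3 : (2 * τ + 4 * τ ^ 2) / N + 6 * |ω| ≤
      ((2 + 6 * K) / a + 8 / a ^ 2) * Real.exp (a * τ) / N := by
    have h4 : (2 * τ + 4 * τ ^ 2) / N + 6 * |ω| ≤ ((2 + 6 * K) * τ + 4 * τ ^ 2) / N := by
      calc _ ≤ (2 * τ + 4 * τ ^ 2) / N + 6 * (K * (1 / N * τ)) := by gcongr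
        _ = _ := by ring
    refine h4.trans ?_
    gcongr
    calc (2 + 6 * K) * τ + 4 * τ ^ 2
        ≤ (2 + 6 * K) * (1 / a * Real.exp (a * τ)) + 4 * (2 / a ^ 2 * Real.exp (a * τ)) := by
          gcongr
      _ = _ := by ring
  have h5 : Real.exp ((η + η') / 2 * τ + 1) * Real.exp (a * τ) =
      Real.exp 1 * Real.exp (η' * τ) := by
    rw [← Real.exp_add, ← Real.exp_add]; congr 1; rw [ha]; ring
  calc _ ≤ Real.exp ((η + η') / 2 * τ + 1) *
        (((2 + 6 * K) / a + 8 / a ^ 2) * Real.exp (a * τ) / N) := by gcongr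
    _ = (Real.exp ((η + η') / 2 * τ + 1) * Real.exp (a * τ)) *
        ((2 + 6 * K) / a + 8 / a ^ 2) / N := by ring
    _ = _ := by rw [h5]; ring

/-- Existence of the bubble beyond radius `ρ`, given the a priori estimate on smaller disks. -/
theorem exists_bubble_of_apriori {h₀ p l γ c ρ : ℝ} (hγ : 0 < γ) (hc : 0 < c) (hc1 : c < 1)
    (hρ : 0 < ρ)
    (h : ∀ s B, IsBubble h₀ p l γ s B → ∀ r, 0 ≤ r → r ≤ ρ → r < s →
      2 * c * γ ≤ radial B r ∧ radial B r ≤ γ) :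
    ∃ s > ρ, ∃ B, IsBubble h₀ p l γ s B := by
  obtain ⟨f, hf, hf0, hfe⟩ := exists_truncated_solution h₀ p l hγ hc hc1
  set B : Plane → ℝ := fun y => f (‖y‖ ^ 2) with hBdef
  have hcγ : 0 < c * γ := by positivity
  have hrad : ∀ r, radial B r = f (r ^ 2) := fun r => by
    simp [radial, hBdef, norm_smul]
  have hcont : Continuous (radial B) := by
    have : radial B = fun r => f (r ^ 2) := funext hrad
    rw [this]; exact hf.continuous.comp (by fun_prop)
  have hBr : ∀ x, B x = radial B ‖x‖ := fun x => (hrad _).symm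
  have hbub : ∀ s, 0 < s → (∀ r, 0 ≤ r → r < s → radial B r ∈ Set.Ioo (c * γ) (2 * γ)) →
      IsBubble h₀ p l γ s B := by
    intro s hs hr
    have hx : ∀ x ∈ Metric.ball (0 : Plane) s, B x ∈ Set.Ioo (c * γ) (2 * γ) := fun x hx => by
      rw [hBr]; exact hr _ (norm_nonneg x) (mem_ball_zero_iff.1 hx)
    exact
      { radius_pos := hs
        contDiffOn := (hf.comp (contDiff_norm_sq ℝ)).contDiffOn
        symmetric := fun x _ y _ hxy => by rw [hBr, hBr y, hxy]
        pos := fun x hxs => hcγ.trans (hx x hxs).1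
        equation := fun x hxs => hfe x ⟨(hx x hxs).1.le, (hx x hxs).2.le⟩
        center := by simp [hBdef, hf0] }
  have h0 : radial B 0 ∈ Set.Ioo (c * γ) (2 * γ) := by
    rw [hrad]; simp only [ne_eq, OfNat.ofNat_ne_zero, not_false_eq_true, zero_pow, hf0]
    constructor <;> nlinarith
  have hin : ∀ r ∈ Set.Icc 0 ρ, radial B r ∈ Set.Ioo (c * γ) (2 * γ) := by
    by_contra! hcon
    obtain ⟨q, hq, hqn⟩ := hcon
    have hcl : IsClosed (radial B ⁻¹' (Set.Ioo (c * γ) (2 * γ))ᶜ) :=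
      isOpen_Ioo.isClosed_compl.preimage hcont
    -- Before the first exit radius m the truncation is inactive, so the function is a bubble on the
    -- disk of radius m. Its bounds [2cγ, γ] pass to r = m by continuity and lie strictly inside
    -- (cγ, 2γ), a contradiction.
    obtain ⟨m, hm⟩ := (isCompact_Icc.inter_right hcl).exists_isLeast ⟨q, hq, hqn⟩
    have hm0 : 0 < m := by
      rcases hm.1.1.1.eq_or_lt with h1 | h1
      · exact absurd h0 (h1 ▸ hm.1.2)
      · exact h1
    have hb := hbub m hm0 fun r hr0 hrm => by
      by_contra hn
      have : m ≤ r := hm.2 ⟨⟨hr0, hrm.le.trans hm.1.1.2⟩, hn⟩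
      linarith
    have hmem : Set.Ico 0 m ⊆ radial B ⁻¹' Set.Icc (2 * c * γ) γ := fun r hr =>
      h m B hb r hr.1 (hr.2.le.trans hm.1.1.2) hr.2
    have hlim : radial B m ∈ Set.Icc (2 * c * γ) γ := by
      have hcl : m ∈ closure (Set.Ico 0 m) := by
        rw [closure_Ico hm0.ne]; exact ⟨hm0.le, le_rfl⟩
      have := closure_mono (Set.image_subset_iff.2 hmem)
        (image_closure_subset_closure_image hcont (Set.mem_image_of_mem _ hcl))
      rwa [isClosed_Icc.closure_eq] at this
    exact hm.1.2 ⟨by nlinarith [hlim.1], by linarith [hlim.2]⟩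
  have hev : ∀ᶠ r in 𝓝 ρ, radial B r ∈ Set.Ioo (c * γ) (2 * γ) :=
    hcont.continuousAt.eventually (isOpen_Ioo.mem_nhds (hin ρ ⟨hρ.le, le_rfl⟩))
  obtain ⟨δ, hδ, hδr⟩ := Metric.eventually_nhds_iff.1 hev
  refine ⟨ρ + δ, by linarith, B, hbub _ (by linarith) fun r hr0 hr => ?_⟩
  rcases le_total r ρ with h1 | h1
  · exact hin r ⟨hr0, h1⟩
  · exact hδr (by rw [Real.dist_eq, abs_of_nonneg (by linarith)]; linarith)

/-! ### From the asymptotic hypotheses to the theorem. -/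

open Asymptotics in
/-- The consequences of the asymptotic hypotheses used at a fixed large height. -/
theorem exists_eventually_setup {η : ℝ} {p μ rbar : ℝ → ℝ}
    (hp : ∀ᶠ γ in atTop, p γ ∈ Set.Icc (1 : ℝ) 2)
    (hμ : ∀ᶠ γ in atTop, 0 < μ γ)
    (hrbar : ∀ᶠ γ in atTop, 0 < rbar γ)
    (hratio : Tendsto (fun γ => μ γ / rbar γ) atTop (𝓝 0))
    (ht : ∀ᶠ γ in atTop, radial (t (μ γ)) (rbar γ) ≤ η * (p γ * γ ^ p γ / 2))
    (hsmall : (fun γ : ℝ => γ ^ (2 * p γ) * rbar γ ^ 2) =O[atTop] (fun _ => (1 : ℝ))) :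
    ∃ D : ℝ, 0 < D ∧ ∀ N₁ : ℝ, ∀ᶠ γ in atTop, p γ ∈ Set.Icc (1 : ℝ) 2 ∧ 0 < μ γ ∧ 0 < γ ∧
      0 < rbar γ ∧ N₁ ≤ γ ^ p γ ∧ ∀ r, 0 ≤ r → r ≤ rbar γ →
        (γ ^ p γ) ^ 2 * (μ γ ^ 2 + r ^ 2) ≤ D ∧
        radial (t (μ γ)) r ≤ η * (p γ * γ ^ p γ / 2) := by
  obtain ⟨c, hc⟩ := hsmall.bound
  -- Since eventually μ ≤ rbar, μ² + r² ≤ 2 rbar²; the added 1 only makes D positive.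
  refine ⟨2 * |c| + 1, by positivity, fun N₁ => ?_⟩
  filter_upwards [hp, hμ, hrbar, ht, hc, hratio.eventually (gt_mem_nhds one_pos),
    eventually_ge_atTop (max 1 N₁)] with γ h1 h2 h3 h4 h5 h6 h7
  have hγ1 : 1 ≤ γ := (le_max_left _ _).trans h7
  have hγ : 0 < γ := by linarith
  refine ⟨h1, h2, hγ, h3, ?_, fun r hr0 hr => ⟨?_, (radial_t_mono h2 hr0 hr).trans h4⟩⟩
  · calc N₁ ≤ γ := (le_max_right _ _).trans h7
      _ = γ ^ (1 : ℝ) := (Real.rpow_one γ).symm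
      _ ≤ γ ^ p γ := Real.rpow_le_rpow_of_exponent_le hγ1 h1.1
  · have h8 : μ γ ≤ rbar γ := by rw [div_lt_one h3] at h6; exact h6.le
    have h9 : γ ^ (2 * p γ) = (γ ^ p γ) ^ 2 := by
      rw [two_mul, Real.rpow_add hγ, sq]
    rw [h9, Real.norm_of_nonneg (by positivity), norm_one, mul_one] at h5
    have h10 : (γ ^ p γ) ^ 2 * (μ γ ^ 2 + r ^ 2) ≤ (γ ^ p γ) ^ 2 * (rbar γ ^ 2 + rbar γ ^ 2) := by
      gcongr
    have := le_abs_self c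
    linarith

end RadialBubble

open Filter Topology Asymptotics in
theorem mainTheorem10 (h₀ η : ℝ) (hh₀ : 0 < h₀) (hη : η ∈ Set.Ioo (0 : ℝ) 1)
    (p μ rbar : ℝ → ℝ)
    (hp : ∀ᶠ γ in atTop, p γ ∈ Set.Icc (1 : ℝ) 2)
    (hμ : ∀ᶠ γ in atTop, 0 < μ γ)
    (hrbar : ∀ᶠ γ in atTop, 0 < rbar γ)
    (hratio : Tendsto (fun γ => μ γ / rbar γ) atTop (𝓝 0))
    (ht : ∀ᶠ γ in atTop,
      RadialBubble.radial (RadialBubble.t (μ γ)) (rbar γ) ≤ η * (p γ * γ ^ p γ / 2))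
    (hsmall : (fun γ : ℝ => γ ^ (2 * p γ) * rbar γ ^ 2) =O[atTop] (fun _ => (1 : ℝ))) :
    -- existence of the bubble beyond the closed disk of radius `rbar γ`
    (∀ᶠ γ in atTop, ∃ s > rbar γ, ∃ B : RadialBubble.Plane → ℝ,
      RadialBubble.IsBubble h₀ (p γ) (RadialBubble.lam (p γ) (μ γ) γ) γ s B) ∧
    -- the upper bound
    (∀ᶠ γ in atTop, ∀ (s : ℝ) (B : RadialBubble.Plane → ℝ),
      RadialBubble.IsBubble h₀ (p γ) (RadialBubble.lam (p γ) (μ γ) γ) γ s B →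
      ∀ r : ℝ, 0 ≤ r → r ≤ rbar γ → r < s → RadialBubble.radial B r ≤ γ) ∧
    -- the pointwise estimate on the remainder
    (∃ C : ℝ, ∀ᶠ γ in atTop, ∀ (s : ℝ) (B : RadialBubble.Plane → ℝ),
      RadialBubble.IsBubble h₀ (p γ) (RadialBubble.lam (p γ) (μ γ) γ) γ s B →
      ∀ r : ℝ, 0 ≤ r → r ≤ rbar γ → r < s →
        |RadialBubble.radial (RadialBubble.w (p γ) (μ γ) γ B) r| ≤
          C * (γ ^ (-p γ) * RadialBubble.radial (RadialBubble.t (μ γ)) r)) ∧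
    -- the estimate on the radial derivative of the remainder
    (∃ C : ℝ, ∀ᶠ γ in atTop, ∀ (s : ℝ) (B : RadialBubble.Plane → ℝ),
      RadialBubble.IsBubble h₀ (p γ) (RadialBubble.lam (p γ) (μ γ) γ) γ s B →
      ∀ r : ℝ, 0 ≤ r → r ≤ rbar γ → r < s →
        |deriv (RadialBubble.radial (RadialBubble.w (p γ) (μ γ) γ B)) r| ≤
          C * (γ ^ (-p γ) * deriv (RadialBubble.radial (RadialBubble.t (μ γ))) r)) ∧
    -- the expansion of the nonlinearity
    (∀ η' ∈ Set.Ioo η 1, ∃ C : ℝ, ∀ᶠ γ in atTop, ∀ (s : ℝ) (B : RadialBubble.Plane → ℝ),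
      RadialBubble.IsBubble h₀ (p γ) (RadialBubble.lam (p γ) (μ γ) γ) γ s B →
      ∀ r : ℝ, 0 ≤ r → r ≤ rbar γ → r < s →
        ∃ δ : ℝ,
          |δ| ≤ C * (Real.exp (η' * RadialBubble.radial (RadialBubble.t (μ γ)) r) / γ ^ p γ) ∧
          RadialBubble.nonlin (p γ) (RadialBubble.lam (p γ) (μ γ) γ) (RadialBubble.radial B r) =
            8 * Real.exp (-2 * RadialBubble.radial (RadialBubble.t (μ γ)) r) /
              ((μ γ) ^ 2 * γ ^ (p γ - 1) * p γ) * (1 + δ)) := by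
  obtain ⟨D, hD, hset⟩ := RadialBubble.exists_eventually_setup hp hμ hrbar hratio ht hsmall
  obtain ⟨K, N₀, hK, hN₀, hap⟩ := RadialBubble.apriori h₀ η D hh₀ hη hD
  have hrem : ∀ N₁ : ℝ, ∀ᶠ γ in atTop, p γ ∈ Set.Icc (1 : ℝ) 2 ∧ 0 < μ γ ∧ 0 < γ ∧
      0 < rbar γ ∧ N₁ ≤ γ ^ p γ ∧ 1 ≤ γ ^ p γ ∧ ∀ r, 0 ≤ r → r ≤ rbar γ →
        RadialBubble.radial (RadialBubble.t (μ γ)) r ≤ η * (p γ * γ ^ p γ / 2) ∧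
        ∀ s B, RadialBubble.IsBubble h₀ (p γ) (RadialBubble.lam (p γ) (μ γ) γ) γ s B → r < s →
        |RadialBubble.radial (RadialBubble.w (p γ) (μ γ) γ B) r| ≤
          K * (1 / γ ^ p γ * RadialBubble.radial (RadialBubble.t (μ γ)) r) ∧
        |deriv (RadialBubble.radial (RadialBubble.w (p γ) (μ γ) γ B)) r| ≤
          K * (1 / γ ^ p γ * (2 * r / (μ γ ^ 2 + r ^ 2))) := by
    intro N₁
    filter_upwards [hset (max N₀ N₁)] with γ ⟨h1, h2, h3, h4, h5, h6⟩
    have h7 : N₀ ≤ γ ^ p γ := (le_max_left _ _).trans h5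
    exact ⟨h1, h2, h3, h4, (le_max_right _ _).trans h5, hN₀.trans h7, fun r hr0 hr =>
      ⟨(h6 r hr0 hr).2, fun s B hB hrs =>
        hap _ _ _ s r B h1 h2 h3 h7 (h6 r hr0 hr).1 (h6 r hr0 hr).2 hB hr0 hrs⟩⟩
  have hη1 : 0 < (1 - η) / 2 := by linarith [hη.2]
  refine ⟨?_, ?_, ⟨K, ?_⟩, ⟨K, ?_⟩, ?_⟩
  -- The two thresholds give the upper bound γ and the lower bound (1-η)γ/2, which is 2cγ for c =
  -- (1-η)/4.
  · filter_upwards [hrem (max K (K / ((1 - η) / 2)))] with γ ⟨h1, h2, h3, h4, h5, _, h7⟩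
    refine RadialBubble.exists_bubble_of_apriori (c := (1 - η) / 4) h3 (by linarith)
      (by linarith [hη.1]) h4 fun s B hB r hr0 hr hrs => ?_
    obtain ⟨h8, h9⟩ := h7 r hr0 hr
    have h10 := (h9 s B hB hrs).1
    refine ⟨?_, RadialBubble.radial_le_of_remainder_le h1 h3 ((le_max_left _ _).trans h5) h10⟩
    have h11 : K ≤ (1 - η) / 2 * γ ^ p γ := by
      have := (le_max_right _ _).trans h5
      rw [div_le_iff₀ hη1] at this
      linarith
    have := RadialBubble.le_radial_of_remainder_le h1 h3 hη hK h11 h8 h10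
    linarith
  · filter_upwards [hrem K] with γ ⟨h1, h2, h3, h4, h5, _, h7⟩
    intro s B hB r hr0 hr hrs
    exact RadialBubble.radial_le_of_remainder_le h1 h3 h5 ((h7 r hr0 hr).2 s B hB hrs).1
  · filter_upwards [hrem K] with γ ⟨h1, h2, h3, h4, h5, _, h7⟩
    intro s B hB r hr0 hr hrs
    rw [Real.rpow_neg h3.le, ← one_div]
    exact ((h7 r hr0 hr).2 s B hB hrs).1
  · filter_upwards [hrem K] with γ ⟨h1, h2, h3, h4, h5, _, h7⟩
    intro s B hB r hr0 hr hrs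
    rw [Real.rpow_neg h3.le, ← one_div, (RadialBubble.hasDerivAt_radial_t h2 r).deriv]
    exact ((h7 r hr0 hr).2 s B hB hrs).2
  · intro η' hη'
    have hd : 0 < (η' - η) / 12 := by linarith [hη'.1]
    refine ⟨Real.exp 1 * ((2 + 6 * K) / ((η' - η) / 2) + 8 / ((η' - η) / 2) ^ 2), ?_⟩
    filter_upwards [hrem (K / ((η' - η) / 12))] with γ ⟨h1, h2, h3, h4, h5, h6, h7⟩
    intro s B hB r hr0 hr hrs
    obtain ⟨h8, h9⟩ := h7 r hr0 hr
    have hpos := hB.radial_pos (r := r) (by rwa [abs_of_nonneg hr0])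
    have h11 : K ≤ (η' - η) / 12 * γ ^ p γ := by
      rw [div_le_iff₀ hd] at h5
      linarith
    refine ⟨RadialBubble.rescaled (p γ) (μ γ) γ B r - 1,
      RadialBubble.abs_rescaled_sub_one_le h1 h3 hη hη' hK h6 h11 h8 hpos (h9 s B hB hrs).1, ?_⟩
    rw [add_sub_cancel]
    exact RadialBubble.nonlin_lam_eq (by linarith [h1.1]) h2 h3 hpos _
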